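/- For a sequence $p=(p_1,\dots,p_n)$ of integers $p_i\ge 2$ let $S_p=[p_1]\times\cdots\times[p_n]$, where $[k]=\{1,\dots,k\}$. Families $A,B\subseteq S_p$ are \emph{$r$-cross-intersecting} if for all $x\in A$, $y\in B$ there are at least $r$ indices $i$ with $x_i=y_i$; such a pair is \emph{maximal} if $|A|\cdot|B|$ is largest possible among all $r$-cross-intersecting pairs of families in $S_p$. For $T\subseteq[n]$, $x_0\in S_p$ and $0\le k\le|T|$, the \emph{Hamming ball} of radius $k$ around $x_0$ in the coordinates $T$ is $\{x\in S_p : |\{i\in T : x_i\ne (x_0)_i\}|\le k\}$; a ball of radius $0$ in the coordinates $T$ is said to be obtained by \emph{fixing} the coordinates in $T$. Let $1\le r\le n$, let $p=(p_1,\dots,p_n)$ be a sequence of integers with $2\le p_1\le p_2\le\cdots\le p_n$, and let $A,B\subseteq S_p$ form an $r$-cross-intersecting pair. (1) If $p_1>r+1$, then $|A|\cdot|B|\le\prod_{i=r+1}^n p_i^2$. In case of equality, $A=B$ and this family is obtained by fixing $r$ coordinates in $S_p$. (2) If $p_1=r+1>4$, then $|A|\cdot|B|\le\prod_{i=r+1}^n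 p_i^2$. In case of equality, $A=B$ and this family is obtained either by fixing $r$ coordinates in $S_p$ or as a Hamming ball of radius $1$ in $r+2$ coordinates $i$, all of which satisfy $p_i=r+1$. (3) There is a function $t(r)=r/2+o(r)$ (as $r\to\infty$), depending on $r$ only, such that if $p_1\ge t(r)$ and $(A,B)$ is a maximal $r$-cross-intersecting pair, then $A$ and $B$ are Hamming balls in a common set $T$ of at most $r+3$ coordinates. -/

import Mathlib

open Filter Asymptotics

namespace CrossInt

/-- The set `S_p` of vectors `x` with `x i` in a set of `p i` elements
(here `{0, …, p i - 1}` instead of `{1, …, p i}`). -/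
abbrev Vec {n : ℕ} (p : Fin n → ℕ) : Type := (i : Fin n) → Fin (p i)

/-- A size vector: all entries are at least `2`. -/
def IsSizeVector {n : ℕ} (p : Fin n → ℕ) : Prop := ∀ i, 2 ≤ p i

/-- `x` and `y` are `r`-intersecting: `d(x, y) ≤ n - r` for the Hamming distance `d`
(written without subtraction). -/
def Intersecting {n : ℕ} {p : Fin n → ℕ} (r : ℕ) (x y : Vec p) : Prop :=
  hammingDist x y + r ≤ n

/-- `A` and `B` are `r`-cross-intersecting. -/
def CrossIntersecting {n : ℕ} {p : Fin n → ℕ} (r : ℕ) (A B : Finset (Vec p)) : Prop :=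
  ∀ x ∈ A, ∀ y ∈ B, Intersecting r x y

/-- `(A, B)` is a maximal `r`-cross-intersecting pair: it maximizes `|A| * |B|` among all
`r`-cross-intersecting pairs of families in `S_p`. -/
def IsMaximalPair {n : ℕ} {p : Fin n → ℕ} (r : ℕ) (A B : Finset (Vec p)) : Prop :=
  CrossIntersecting r A B ∧
    ∀ A' B' : Finset (Vec p), CrossIntersecting r A' B' → A'.card * B'.card ≤ A.card * B.card

/-- The Hamming ball of radius `k` around `x₀` in the coordinates `T`. -/
def hammingBall {n : ℕ} {p : Fin n → ℕ} (x₀ : Vec p) (T : Finset (Fin n)) (k : ℕ) :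
    Finset (Vec p) :=
  {x | (T.filter fun i => x i ≠ x₀ i).card ≤ k}

/-- `A` is a Hamming ball in the coordinates `T`, of some radius `0 ≤ k ≤ |T|`. -/
def IsBallIn {n : ℕ} {p : Fin n → ℕ} (T : Finset (Fin n)) (A : Finset (Vec p)) : Prop :=
  ∃ (x₀ : Vec p) (k : ℕ), k ≤ T.card ∧ A = hammingBall x₀ T k

/-- `A` is obtained by fixing the coordinates in `T`: it is a ball of radius `0` in `T`. -/
def IsFixing {n : ℕ} {p : Fin n → ℕ} (T : Finset (Fin n)) (A : Finset (Vec p)) : Prop :=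
  ∃ x₀ : Vec p, A = hammingBall x₀ T 0

end CrossInt

/-! Maximality is exploited one coordinate at a time. Restrict A to the value l and B to a value m ≠
l in coordinate i, then free that coordinate: the pair stays cross-intersecting, so maximality
bounds the product of the two slices. With at least three values, either neither family depends on
i, or both share a popular value that all but a 1/p_i fraction of each takes
(`IsMaximalPair.irrelevant_or_concentrated`). This gives a set T of relevant coordinates and a
center x₀ (`Concentrated`).

If |T| ≤ r + 3 and p_i ≥ 5 on T, averaging over one family forces the other close to x₀, leaving
concentric balls whose radii sum to |T| - r (`Concentrated.exists_eq_hammingBall`). The bound on |T|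
comes from entropy: concentration on T makes log|A| and log|B| small, while fixing the cheapest r
coordinates of T is a competitor (`Concentrated.card_le`). The resulting inequality in r and p_i
holds for p_i ≥ r + 1 ≥ 5, and from a threshold r/2 + o(r) on, which gives (3).

For (2), size comparisons exclude all radii except (0,0) and (1,1), and the latter unless p_i = r +
1 on T. For (1), no entropy is needed: a union bound over r + 1 relevant coordinates only just
matches the size obtained by fixing r of them, and its equality case is contradictory
(`Concentrated.tight`, `Concentrated.card_eq_of_le`). -/

namespace CrossInt

variable {n : ℕ} {p : Fin n → ℕ}

/-! ### Distances on a set of coordinates -/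

/-- The number of coordinates in `T` in which `x` and `y` differ. -/
def distOn (T : Finset (Fin n)) (x y : Vec p) : ℕ := (T.filter fun i => x i ≠ y i).card

lemma mem_hammingBall {x₀ x : Vec p} {T : Finset (Fin n)} {k : ℕ} :
    x ∈ hammingBall x₀ T k ↔ distOn T x x₀ ≤ k := by
  simp [hammingBall, distOn]

lemma distOn_comm (T : Finset (Fin n)) (x y : Vec p) : distOn T x y = distOn T y x := by
  simp only [distOn, ne_comm]

lemma distOn_triangle (T : Finset (Fin n)) (x y z : Vec p) :
    distOn T x z ≤ distOn T x y + distOn T y z := by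
  unfold distOn
  refine (Finset.card_le_card ?_).trans (Finset.card_union_le _ _)
  intro i hi
  simp only [Finset.mem_filter, Finset.mem_union] at hi ⊢
  by_cases h : x i = y i
  · right; exact ⟨hi.1, h ▸ hi.2⟩
  · left; exact ⟨hi.1, h⟩

lemma distOn_eq_zero {T : Finset (Fin n)} {x y : Vec p} :
    distOn T x y = 0 ↔ ∀ i ∈ T, x i = y i := by
  simp [distOn, Finset.filter_eq_empty_iff]

lemma distOn_congr {T : Finset (Fin n)} {x x' y : Vec p} (h : ∀ i ∈ T, x i = x' i) :
    distOn T x y = distOn T x' y := by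
  unfold distOn
  congr 1
  exact Finset.filter_congr fun i hi => by rw [h i hi]

lemma hammingDist_eq (T : Finset (Fin n)) (x y : Vec p) :
    hammingDist x y = distOn T x y + distOn Tᶜ x y := by
  unfold hammingDist distOn
  rw [← Finset.card_union_of_disjoint, ← Finset.filter_union, Finset.union_compl]
  exact (disjoint_compl_right).mono (Finset.filter_subset _ _) (Finset.filter_subset _ _)

lemma distOn_le_card (T : Finset (Fin n)) (x y : Vec p) : distOn T x y ≤ T.card :=
  Finset.card_filter_le _ _

lemma sum_distOn (T : Finset (Fin n)) (A : Finset (Vec p)) (y : Vec p) :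
    ∑ x ∈ A, distOn T x y = ∑ i ∈ T, (A.filter fun x => x i ≠ y i).card := by
  simp only [distOn, Finset.card_filter]
  exact Finset.sum_comm

/-- If `x` and `y` are close enough in the coordinates `T`, then they are `r`-intersecting. -/
lemma intersecting_of_distOn {T : Finset (Fin n)} {r : ℕ} {x y : Vec p}
    (h : distOn T x y + r ≤ T.card) : Intersecting r x y := by
  unfold Intersecting
  have h1 := distOn_le_card Tᶜ x y
  rw [hammingDist_eq T]
  have h2 := Finset.card_add_card_compl T
  rw [Fintype.card_fin] at h2
  omega

lemma intersecting_comm {r : ℕ} {x y : Vec p} : Intersecting r x y ↔ Intersecting r y x := by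
  unfold Intersecting; rw [hammingDist_comm]

lemma CrossIntersecting.symm {r : ℕ} {A B : Finset (Vec p)} (h : CrossIntersecting r A B) :
    CrossIntersecting r B A := fun x hx y hy => intersecting_comm.1 (h y hy x hx)

/-- Triangle inequality through the common center. These pairs serve as competitors for a maximal
pair. -/
lemma crossIntersecting_hammingBall {T : Finset (Fin n)} {r a b : ℕ} (x₀ : Vec p)
    (h : a + b + r ≤ T.card) :
    CrossIntersecting r (hammingBall x₀ T a) (hammingBall x₀ T b) := by
  intro x hx y hy
  rw [mem_hammingBall] at hx hy
  apply intersecting_of_distOn (T := T)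
  have := distOn_triangle T x x₀ y
  rw [distOn_comm T x₀ y] at this
  omega

lemma hammingBall_mono (x₀ : Vec p) (T : Finset (Fin n)) {a b : ℕ} (h : a ≤ b) :
    hammingBall x₀ T a ⊆ hammingBall x₀ T b := by
  intro x hx
  rw [mem_hammingBall] at hx ⊢
  omega

lemma center_mem_hammingBall (x₀ : Vec p) (T : Finset (Fin n)) (k : ℕ) :
    x₀ ∈ hammingBall x₀ T k := by
  rw [mem_hammingBall, distOn_eq_zero.2 fun _ _ => rfl]
  exact Nat.zero_le _

/-! ### Cardinalities -/

lemma card_agree (T : Finset (Fin n)) (z : Vec p) :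
    (Finset.univ.filter fun x : Vec p => ∀ i ∈ T, x i = z i).card = ∏ i ∈ Tᶜ, p i := by
  have : (Finset.univ.filter fun x : Vec p => ∀ i ∈ T, x i = z i) =
      Fintype.piFinset fun i => if i ∈ T then {z i} else Finset.univ := by
    ext x
    simp only [Finset.mem_filter, Finset.mem_univ, true_and, Fintype.mem_piFinset]
    refine forall_congr' fun i => ?_
    by_cases h : i ∈ T <;> simp [h]
  rw [this, Fintype.card_piFinset, ← Finset.prod_mul_prod_compl T]
  rw [Finset.prod_eq_one (s := T) (fun i hi => by simp [hi]), one_mul]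
  exact Finset.prod_congr rfl fun i hi => by simp [Finset.mem_compl.1 hi]

lemma card_hammingBall_zero (T : Finset (Fin n)) (x₀ : Vec p) :
    (hammingBall x₀ T 0).card = ∏ i ∈ Tᶜ, p i := by
  rw [← card_agree T x₀]
  congr 1
  ext x
  simp [mem_hammingBall, distOn_eq_zero]

/-- The vectors whose `i`-th coordinate can be replaced by `l` to give an element of `A`. -/
def extendSlice (i : Fin n) (l : Fin (p i)) (A : Finset (Vec p)) : Finset (Vec p) :=
  Finset.univ.filter fun x => Function.update x i l ∈ A

lemma mem_extendSlice {i : Fin n} {l : Fin (p i)} {A : Finset (Vec p)} {x : Vec p} :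
    x ∈ extendSlice i l A ↔ Function.update x i l ∈ A := by
  simp [extendSlice]

lemma card_extendSlice (i : Fin n) (l : Fin (p i)) (A : Finset (Vec p)) :
    (extendSlice i l A).card = p i * (A.filter fun x => x i = l).card := by
  have : (extendSlice i l A).card =
      ((Finset.univ : Finset (Fin (p i))) ×ˢ (A.filter fun x => x i = l)).card := by
    refine Finset.card_nbij' (fun x => (x i, Function.update x i l))
      (fun q => Function.update q.2 i q.1) ?_ ?_ ?_ ?_
    · intro x hx
      simpa using mem_extendSlice.1 hx
    · rintro ⟨v, y⟩ hy
      have hy' : y ∈ A ∧ y i = l := by simpa using hy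
      simp only [SetLike.mem_coe, mem_extendSlice, Function.update_idem]
      rw [← hy'.2, Function.update_eq_self]
      exact hy'.1
    · intro x _
      simp
    · rintro ⟨v, y⟩ hy
      have hy' : y ∈ A ∧ y i = l := by simpa using hy
      simp only [Function.update_self, Function.update_idem, Prod.mk.injEq, true_and]
      rw [← hy'.2, Function.update_eq_self]
  rw [this, Finset.card_product, Finset.card_univ, Fintype.card_fin]

/-! ### Maximal pairs -/

lemma IsMaximalPair.symm {r : ℕ} {A B : Finset (Vec p)} (h : IsMaximalPair r A B) :
    IsMaximalPair r B A :=
  ⟨h.1.symm, fun A' B' h' => by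
    rw [mul_comm A'.card, mul_comm B.card]; exact h.2 B' A' h'.symm⟩

lemma exists_isMaximalPair (p : Fin n → ℕ) (r : ℕ) :
    ∃ A B : Finset (Vec p), IsMaximalPair r A B := by
  classical
  let s : Finset (Finset (Vec p) × Finset (Vec p)) :=
    Finset.univ.filter fun q => CrossIntersecting r q.1 q.2
  have hs : s.Nonempty := ⟨(∅, ∅), Finset.mem_filter.2 ⟨Finset.mem_univ _, by simp [CrossIntersecting]⟩⟩
  obtain ⟨q, hq, hmax⟩ := Finset.exists_max_image s (fun q => q.1.card * q.2.card) hs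
  refine ⟨q.1, q.2, (Finset.mem_filter.1 hq).2, fun A' B' h => ?_⟩
  exact hmax (A', B') (by simpa [s] using h)

/-- The product of the sizes of a maximal pair is at least that of the pair obtained by fixing
`r` coordinates. -/
lemma IsMaximalPair.prod_le {r : ℕ} {A B : Finset (Vec p)} (h : IsMaximalPair r A B)
    (hp : ∀ i, 0 < p i) {R : Finset (Fin n)} (hR : R.card = r) :
    (∏ i ∈ Rᶜ, p i) * (∏ i ∈ Rᶜ, p i) ≤ A.card * B.card := by
  let x₀ : Vec p := fun i => ⟨0, hp i⟩
  have := h.2 _ _ (crossIntersecting_hammingBall (T := R) (r := r) (a := 0) (b := 0) x₀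
    (by omega))
  rwa [card_hammingBall_zero] at this

lemma IsMaximalPair.mul_pos {r : ℕ} {A B : Finset (Vec p)} (h : IsMaximalPair r A B)
    (hp : ∀ i, 0 < p i) (hrn : r ≤ n) : 0 < A.card * B.card := by
  obtain ⟨R, -, hR⟩ := Finset.exists_subset_card_eq (s := (Finset.univ : Finset (Fin n)))
    (n := r) (by simpa using hrn)
  refine lt_of_lt_of_le ?_ (h.prod_le hp hR)
  exact Nat.mul_pos (Finset.prod_pos fun i _ => hp i) (Finset.prod_pos fun i _ => hp i)

/-- A maximal pair is not properly contained in another cross-intersecting pair. -/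
lemma IsMaximalPair.eq_of_subset {r : ℕ} {A B A' B' : Finset (Vec p)} (h : IsMaximalPair r A B)
    (hpos : 0 < A.card * B.card) (h' : CrossIntersecting r A' B') (hA : A ⊆ A') (hB : B ⊆ B') :
    A = A' ∧ B = B' := by
  have h1 := h.2 A' B' h'
  have h2 := Finset.card_le_card hA
  have h3 := Finset.card_le_card hB
  have hA0 : 0 < A.card := Nat.pos_of_mul_pos_right hpos
  have hB0 : 0 < B.card := Nat.pos_of_mul_pos_left hpos
  constructor
  · refine Finset.eq_of_subset_of_card_le hA ?_
    by_contra! hlt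
    nlinarith
  · refine Finset.eq_of_subset_of_card_le hB ?_
    by_contra! hlt
    nlinarith

lemma IsMaximalPair.mem_right {r : ℕ} {A B : Finset (Vec p)} (h : IsMaximalPair r A B)
    (hpos : 0 < A.card * B.card) {y : Vec p} (hy : ∀ x ∈ A, Intersecting r x y) : y ∈ B := by
  classical
  have := (h.eq_of_subset hpos (A' := A) (B' := insert y B) ?_ subset_rfl
    (Finset.subset_insert _ _)).2
  · rw [this]; exact Finset.mem_insert_self _ _
  · intro x hx z hz
    rcases Finset.mem_insert.1 hz with rfl | hz
    · exact hy x hx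
    · exact h.1 x hx z hz

/-- Members of slices at distinct values already disagree in coordinate `i`, so freeing it destroys
no agreement. -/
lemma CrossIntersecting.extendSlice {r : ℕ} {A B : Finset (Vec p)} (h : CrossIntersecting r A B)
    {i : Fin n} {l m : Fin (p i)} (hlm : l ≠ m) :
    CrossIntersecting r (extendSlice i l A) (extendSlice i m B) := by
  intro x hx y hy
  have := h _ (mem_extendSlice.1 hx) _ (mem_extendSlice.1 hy)
  unfold Intersecting at *
  refine le_trans (Nat.add_le_add_right ?_ r) this
  unfold hammingDist
  refine Finset.card_le_card fun j hj => ?_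
  simp only [Finset.mem_filter, Finset.mem_univ, true_and] at hj ⊢
  by_cases hji : j = i
  · subst hji; simpa using hlm
  · simpa [Function.update_of_ne hji] using hj

/-- The family `A` does not depend on the coordinate `i`. -/
def Irrelevant (i : Fin n) (A : Finset (Vec p)) : Prop :=
  ∀ x ∈ A, ∀ v, Function.update x i v ∈ A

/-- If all cross pairs of slices of a maximal pair are extremal, then the coordinate is
irrelevant. -/
lemma IsMaximalPair.irrelevant_right {r : ℕ} {A B : Finset (Vec p)} (h : IsMaximalPair r A B)
    (hpos : 0 < A.card * B.card) {i : Fin n} (hpi : 3 ≤ p i)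
    (hs : ∀ l m : Fin (p i), l ≠ m →
      (extendSlice i l A).card * (extendSlice i m B).card = A.card * B.card) :
    Irrelevant i B := by
  -- The extended slices form a maximal pair, so the one at `m'` contains everything compatible with
  -- the slice of `A` at `l`. A third value `l` links any two slices of `B`, hence `3 ≤ p i`.
  have key : ∀ m m' l : Fin (p i), l ≠ m → l ≠ m' → extendSlice i m B ⊆ extendSlice i m' B := by
    intro m m' l hm hm' y hy
    have hmax : IsMaximalPair r (extendSlice i l A) (extendSlice i m' B) :=
      ⟨h.1.extendSlice hm', fun A' B' h' => by rw [hs l m' hm']; exact h.2 A' B' h'⟩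
    exact hmax.mem_right (by rw [hs l m' hm']; exact hpos)
      fun x hx => h.1.extendSlice hm x hx y hy
  intro y hy v
  obtain ⟨l, hl⟩ : ∃ l : Fin (p i), l ∉ ({y i, v} : Finset (Fin (p i))) := by
    by_contra! hall
    have h1 := Finset.card_le_card (fun l _ => hall l : Finset.univ ⊆ _)
    have h2 := Finset.card_le_two (a := y i) (b := v)
    rw [Finset.card_univ, Fintype.card_fin] at h1
    omega
  simp only [Finset.mem_insert, Finset.mem_singleton, not_or] at hl
  refine mem_extendSlice.1 (key (y i) v l hl.1 hl.2 (mem_extendSlice.2 ?_))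
  rwa [Function.update_eq_self]

/-- A product bound for the fractions of two families in the different slices. -/
lemma one_sub_le_of_mul_le {q u v : ℝ} (hq : 1 < q) (hu : 1 / q ≤ u) (hv : 1 / q < v)
    (h1 : (1 - u) * v ≤ (q - 1) / q ^ 2) (h2 : (1 - v) * u ≤ (q - 1) / q ^ 2) :
    1 - u ≤ 1 / q ∧ 1 - v ≤ 1 / q := by
  set e := 1 / q with he
  have e0 : 0 < e := by positivity
  have e1 : e < 1 := by rw [he, div_lt_one (by linarith)]; exact hq
  have hq' : (q - 1) / q ^ 2 = e - e ^ 2 := by rw [he]; field_simp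
  rw [hq'] at h1 h2
  have hu' : e < u := by
    rcases hu.lt_or_eq with h | h
    · exact h
    · rw [← h] at h1 h2
      exfalso
      nlinarith
  -- The smaller of `u`, `v`, call it w, satisfies w(1 - w) ≤ e(1 - e) and w > e; by concavity 1 - w
  -- ≤ e.
  rcases le_total u v with h | h
  · have : (1 - u) ≤ e := by
      by_contra! hc
      nlinarith [mul_pos (sub_pos.2 hu') (sub_pos.2 hc), mul_nonneg (e0.le.trans hc.le) (sub_nonneg.2 h)]
    exact ⟨this, by linarith⟩
  · have : (1 - v) ≤ e := by
      by_contra! hc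
      nlinarith [mul_pos (sub_pos.2 hv) (sub_pos.2 hc), mul_nonneg (e0.le.trans hc.le) (sub_nonneg.2 h)]
    exact ⟨by linarith, this⟩

lemma sum_card_slices (i : Fin n) (A : Finset (Vec p)) :
    ∑ l : Fin (p i), (A.filter fun x => x i = l).card = A.card :=
  (Finset.card_eq_sum_card_fiberwise fun _ _ => Finset.mem_univ _).symm

/-- In each relevant coordinate, a maximal pair is concentrated on a common value. -/
lemma IsMaximalPair.irrelevant_or_concentrated {r : ℕ} {A B : Finset (Vec p)}
    (h : IsMaximalPair r A B) (hpos : 0 < A.card * B.card) {i : Fin n} (hpi : 3 ≤ p i) :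
    (Irrelevant i A ∧ Irrelevant i B) ∨ ∃ l : Fin (p i),
      p i * (A.filter fun x => x i ≠ l).card ≤ A.card ∧
      p i * (B.filter fun x => x i ≠ l).card ≤ B.card := by
  classical
  have hα : (0 : ℝ) < A.card := by exact_mod_cast Nat.pos_of_mul_pos_right hpos
  have hβ : (0 : ℝ) < B.card := by exact_mod_cast Nat.pos_of_mul_pos_left hpos
  have hq : (3 : ℝ) ≤ p i := by exact_mod_cast hpi
  have hq0 : (0 : ℝ) < p i := by linarith
  set u : Fin (p i) → ℝ := fun l => (A.filter fun x => x i = l).card / A.card with hu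
  set v : Fin (p i) → ℝ := fun l => (B.filter fun x => x i = l).card / B.card with hv
  have hus : ∑ l, u l = 1 := by
    rw [hu, ← Finset.sum_div, ← Nat.cast_sum, sum_card_slices, div_self hα.ne']
  have hvs : ∑ l, v l = 1 := by
    rw [hv, ← Finset.sum_div, ← Nat.cast_sum, sum_card_slices, div_self hβ.ne']
  have hmul : ∀ l m, u l * v m * (p i * p i) * (A.card * B.card) =
      (extendSlice i l A).card * (extendSlice i m B).card := by
    intro l m
    rw [card_extendSlice, card_extendSlice, hu, hv]
    push_cast
    field_simp
  have huv : ∀ l m, l ≠ m → u l * v m * (p i * p i) ≤ 1 := by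
    intro l m hlm
    have h1 : ((extendSlice i l A).card * (extendSlice i m B).card : ℝ) ≤ A.card * B.card := by
      exact_mod_cast h.2 _ _ (h.1.extendSlice hlm)
    rw [← hmul] at h1
    have : 0 < (A.card * B.card : ℝ) := by positivity
    nlinarith
  have hne : ∀ (C : Finset (Vec p)) (l : Fin (p i)), (0 : ℝ) < C.card →
      1 - ((C.filter fun x => x i = l).card / C.card : ℝ) ≤ 1 / p i →
      p i * (C.filter fun x => x i ≠ l).card ≤ C.card := by
    intro C l hC hl
    have h1 : ((C.filter fun x => x i = l).card : ℝ) + (C.filter fun x => x i ≠ l).card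
        = C.card := by
      exact_mod_cast Finset.card_filter_add_card_filter_not (s := C) (fun x => x i = l)
    have h2 : (p i : ℝ) * (C.filter fun x => x i ≠ l).card ≤ C.card := by
      rw [one_sub_div hC.ne', ← h1, add_sub_cancel_left, h1, div_le_div_iff₀ hC hq0] at hl
      linarith
    exact_mod_cast h2
  have : Nonempty (Fin (p i)) := ⟨⟨0, by omega⟩⟩
  obtain ⟨l, -, hl⟩ := Finset.exists_max_image Finset.univ u Finset.univ_nonempty
  have hsum_le : ∀ w : Fin (p i) → ℝ, ∑ k, w k = 1 → (∀ k, w k ≤ 1 / p i) →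
      ∀ k, w k = 1 / p i := by
    intro w hw hle k
    have := (Finset.sum_eq_sum_iff_of_le (s := Finset.univ) (f := w)
      (g := fun _ => (1 : ℝ) / p i) (fun k _ => hle k)).1 (by
        rw [hw, Finset.sum_const, Finset.card_univ, Fintype.card_fin, nsmul_eq_mul]
        field_simp)
    exact this k (Finset.mem_univ k)
  have hul : 1 / (p i : ℝ) ≤ u l := by
    have : ∑ k, u k ≤ ∑ k : Fin (p i), u l := Finset.sum_le_sum fun k hk => hl k hk
    rw [hus, Finset.sum_const, Finset.card_univ, Fintype.card_fin, nsmul_eq_mul] at this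
    rw [div_le_iff₀ hq0]
    linarith
  have hul0 : 0 < u l := lt_of_lt_of_le (by positivity) hul
  have hvm : ∀ m, m ≠ l → v m ≤ 1 / (u l * (p i * p i)) := by
    intro m hm
    rw [le_div_iff₀ (by positivity)]
    linarith [huv l m hm.symm]
  have hvm' : ∀ m, m ≠ l → v m ≤ 1 / p i := by
    intro m hm
    refine (hvm m hm).trans ?_
    rw [div_le_div_iff_of_pos_left one_pos (by positivity) hq0]
    rw [div_le_iff₀ hq0] at hul
    nlinarith
  -- If `l` is not popular in `B`, every slice of `B` has fraction at most 1/p_i, so both families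
  -- are equidistributed and every slice bound is tight.
  rcases le_or_gt (v l) (1 / p i) with hvl | hvl
  · left
    have hv1 : ∀ k, v k = 1 / p i := hsum_le v hvs fun k => by
      by_cases hk : k = l
      · rw [hk]; exact hvl
      · exact hvm' k hk
    have hu1 : ∀ k, u k = 1 / p i := hsum_le u hus fun k => by
      obtain ⟨m, hm⟩ : ∃ m : Fin (p i), m ≠ k := by
        have : Nontrivial (Fin (p i)) := Fin.nontrivial_iff_two_le.2 (by omega)
        exact exists_ne k
      have := huv k m hm.symm
      rw [hv1 m] at this
      rw [le_div_iff₀ hq0]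
      calc u k * p i = u k * (1 / p i) * (p i * p i) := by field_simp
        _ ≤ 1 := this
    have hs : ∀ l m : Fin (p i),
        (extendSlice i l A).card * (extendSlice i m B).card = A.card * B.card := by
      intro l m
      have := hmul l m
      rw [hu1, hv1] at this
      have h3 : (1 : ℝ) / p i * (1 / p i) * (p i * p i) = 1 := by field_simp
      rw [h3, one_mul] at this
      exact_mod_cast this.symm
    refine ⟨h.symm.irrelevant_right (by rwa [mul_comm]) hpi fun l m _ => ?_,
      h.irrelevant_right hpos hpi fun l m _ => hs l m⟩
    rw [mul_comm, mul_comm B.card]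
    exact hs m l
  · right
    have hvl0 : 0 < v l := lt_of_lt_of_le (by positivity) hvl.le
    have hum : ∀ m, m ≠ l → u m ≤ 1 / (v l * (p i * p i)) := by
      intro m hm
      rw [le_div_iff₀ (by positivity)]
      linarith [huv m l hm]
    have hrest : ∀ (w : Fin (p i) → ℝ) (c : ℝ), ∑ k, w k = 1 → (∀ m, m ≠ l → w m ≤ c) →
        1 - w l ≤ (p i - 1) * c := by
      intro w c hw hc
      rw [← Finset.add_sum_erase _ _ (Finset.mem_univ l)] at hw
      have := Finset.sum_le_card_nsmul (Finset.univ.erase l) w c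
        fun m hm => hc m (Finset.ne_of_mem_erase hm)
      rw [Finset.card_erase_of_mem (Finset.mem_univ l), Finset.card_univ, Fintype.card_fin,
        nsmul_eq_mul, Nat.cast_sub (by omega), Nat.cast_one] at this
      linarith
    have h1 : (1 - u l) * v l ≤ (p i - 1) / (p i : ℝ) ^ 2 := by
      refine (mul_le_mul_of_nonneg_right (hrest u _ hus hum) hvl0.le).trans_eq ?_
      field_simp
    have h2 : (1 - v l) * u l ≤ (p i - 1) / (p i : ℝ) ^ 2 := by
      refine (mul_le_mul_of_nonneg_right (hrest v _ hvs hvm) hul0.le).trans_eq ?_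
      field_simp
    obtain ⟨h3, h4⟩ := one_sub_le_of_mul_le (by linarith) hul hvl h1 h2
    exact ⟨l, hne A l hα h3, hne B l hβ h4⟩

/-! ### Concentrated pairs -/

/-- A maximal pair that does not depend on the coordinates outside `T`, and in which, for each
`i ∈ T`, at most a `1 / p i` fraction of either family differs from `x₀` in the coordinate `i`. -/
structure Concentrated (r : ℕ) (A B : Finset (Vec p)) (T : Finset (Fin n)) (x₀ : Vec p) :
    Prop where
  isMaximalPair : IsMaximalPair r A B
  pos : 0 < A.card * B.card
  irrelevant_left : ∀ i ∉ T, Irrelevant i A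
  irrelevant_right : ∀ i ∉ T, Irrelevant i B
  card_left : ∀ i ∈ T, p i * (A.filter fun x => x i ≠ x₀ i).card ≤ A.card
  card_right : ∀ i ∈ T, p i * (B.filter fun x => x i ≠ x₀ i).card ≤ B.card

lemma IsMaximalPair.exists_concentrated {r : ℕ} {A B : Finset (Vec p)} (h : IsMaximalPair r A B)
    (hp : ∀ i, 3 ≤ p i) (hrn : r ≤ n) : ∃ T x₀, Concentrated r A B T x₀ := by
  classical
  have hpos := h.mul_pos (fun i => by have := hp i; omega) hrn
  have key := fun i => h.irrelevant_or_concentrated hpos (hp i)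
  have key' : ∀ i, ∃ l : Fin (p i), ¬(Irrelevant i A ∧ Irrelevant i B) →
      p i * (A.filter fun x => x i ≠ l).card ≤ A.card ∧
      p i * (B.filter fun x => x i ≠ l).card ≤ B.card := by
    intro i
    by_cases hi : Irrelevant i A ∧ Irrelevant i B
    -- The center is arbitrary in irrelevant coordinates.
    · exact ⟨⟨0, by have := hp i; omega⟩, fun h => absurd hi h⟩
    · obtain ⟨l, hl⟩ := (key i).resolve_left hi
      exact ⟨l, fun _ => hl⟩
  choose x₀ hx₀ using key'
  refine ⟨Finset.univ.filter fun i => ¬(Irrelevant i A ∧ Irrelevant i B), x₀, h, hpos,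
    fun i hi => ?_, fun i hi => ?_, fun i hi => ?_, fun i hi => ?_⟩
  · simp only [Finset.mem_filter, Finset.mem_univ, true_and, not_not] at hi
    exact hi.1
  · simp only [Finset.mem_filter, Finset.mem_univ, true_and, not_not] at hi
    exact hi.2
  · exact (hx₀ i (Finset.mem_filter.1 hi).2).1
  · exact (hx₀ i (Finset.mem_filter.1 hi).2).2

lemma mem_of_forall_irrelevant {A : Finset (Vec p)} {T : Finset (Fin n)}
    (hA : ∀ i ∉ T, Irrelevant i A) {x z : Vec p} (hx : x ∈ A) (hz : ∀ i ∈ T, z i = x i) :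
    z ∈ A := by
  classical
  have key : ∀ S : Finset (Fin n), Disjoint S T → (fun i => if i ∈ S then z i else x i) ∈ A := by
    intro S
    induction S using Finset.induction_on with
    | empty => intro _; simpa using hx
    | insert j S hj ih =>
      intro hd
      rw [Finset.disjoint_insert_left] at hd
      convert hA j hd.1 _ (ih hd.2) (z j) using 1
      funext i
      by_cases hij : i = j
      · subst hij; simp
      · simp [hij]
  convert key Tᶜ disjoint_compl_left using 1
  funext i
  by_cases hi : i ∈ T
  · simp [hi, hz i hi]
  · simp [hi]

lemma mul_card_filter_ne_le {A : Finset (Vec p)} {i : Fin n} {l : Fin (p i)} {q : ℕ}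
    (hq : q ≤ p i) (h : p i * (A.filter fun x => x i ≠ l).card ≤ A.card) :
    q * (A.filter fun x => x i ≠ l).card ≤ A.card :=
  (Nat.mul_le_mul_right _ hq).trans h

/-- Union bound: if few elements of `A` differ from `x₀` in each coordinate of `U`, then many
elements agree with `x₀` on all of `U`. -/
lemma card_le_card_agree_add (A : Finset (Vec p)) (U : Finset (Fin n)) (x₀ : Vec p) :
    A.card ≤ (A.filter fun x => ∀ i ∈ U, x i = x₀ i).card +
      ∑ i ∈ U, (A.filter fun x => x i ≠ x₀ i).card := by
  classical
  rw [← Finset.card_filter_add_card_filter_not (s := A) (fun x => ∀ i ∈ U, x i = x₀ i)]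
  refine Nat.add_le_add_left ?_ _
  refine (Finset.card_le_card ?_).trans Finset.card_biUnion_le
  intro x hx
  simp only [Finset.mem_filter, not_forall, Finset.mem_biUnion] at hx ⊢
  obtain ⟨hxA, i, hi, hne⟩ := hx
  exact ⟨i, hi, hxA, hne⟩

namespace Concentrated

variable {r : ℕ} {A B : Finset (Vec p)} {T : Finset (Fin n)} {x₀ : Vec p}

lemma symm (h : Concentrated r A B T x₀) : Concentrated r B A T x₀ :=
  ⟨h.isMaximalPair.symm, by rw [mul_comm]; exact h.pos, h.irrelevant_right, h.irrelevant_left,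
    h.card_right, h.card_left⟩

lemma card_left_pos (h : Concentrated r A B T x₀) : 0 < A.card :=
  Nat.pos_of_mul_pos_right h.pos

/-- Outside `T`, `y` can be altered within `B` to disagree with `x` everywhere, so all `r`
agreements must lie in `T`. -/
lemma distOn_add_le (h : Concentrated r A B T x₀) (hp : ∀ i, 2 ≤ p i) {x y : Vec p}
    (hx : x ∈ A) (hy : y ∈ B) : distOn T x y + r ≤ T.card := by
  classical
  have hne : ∀ i, ∃ v : Fin (p i), v ≠ x i := fun i =>
    have : Nontrivial (Fin (p i)) := Fin.nontrivial_iff_two_le.2 (hp i)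
    exists_ne (x i)
  choose w hw using hne
  let z : Vec p := fun i => if i ∈ T then y i else w i
  have hzB : z ∈ B := mem_of_forall_irrelevant h.irrelevant_right hy fun i hi => by simp [z, hi]
  have h1 := h.isMaximalPair.1 x hx z hzB
  unfold Intersecting at h1
  rw [hammingDist_eq T] at h1
  have h2 : distOn T x z = distOn T x y := by
    rw [distOn_comm, distOn_comm T x]
    exact distOn_congr fun i hi => by simp [z, hi]
  have h3 : distOn Tᶜ x z = Tᶜ.card := by
    unfold distOn
    congr 1
    refine Finset.filter_true_of_mem fun i hi => ?_
    simp only [z, if_neg (Finset.mem_compl.1 hi)]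
    exact (hw i).symm
  have h4 := Finset.card_add_card_compl T
  rw [Fintype.card_fin] at h4
  omega

lemma le_card (h : Concentrated r A B T x₀) (hp : ∀ i, 2 ≤ p i) : r ≤ T.card := by
  obtain ⟨x, hx⟩ := Finset.card_pos.1 h.card_left_pos
  obtain ⟨y, hy⟩ := Finset.card_pos.1 h.symm.card_left_pos
  have := h.distOn_add_le hp hx hy
  omega

/-- A pair contained in complementary balls around the center consists of these balls. -/
lemma eq_hammingBall (h : Concentrated r A B T x₀) {a b : ℕ} (hab : a + b + r = T.card)
    (hA : A ⊆ hammingBall x₀ T a) (hB : B ⊆ hammingBall x₀ T b) :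
    A = hammingBall x₀ T a ∧ B = hammingBall x₀ T b :=
  h.isMaximalPair.eq_of_subset h.pos (crossIntersecting_hammingBall x₀ hab.le) hA hB

/-- No element of either family is at distance more than `|T| - r` from the center. -/
lemma subset_hammingBall (h : Concentrated r A B T x₀) (hp : ∀ i, 2 ≤ p i) {s : ℕ}
    (hs : s + r = T.card) (hpT : ∀ i ∈ T, s + 2 ≤ p i) : B ⊆ hammingBall x₀ T s := by
  intro y hy
  rw [mem_hammingBall]
  by_contra! hlt
  obtain ⟨S, hS, hScard⟩ := Finset.exists_subset_card_eq
    (s := T.filter fun i => y i ≠ x₀ i) (n := s + 1) hlt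
  have h1 : ∑ x ∈ A, distOn T x y ≤ A.card * s := by
    rw [← smul_eq_mul]
    refine Finset.sum_le_card_nsmul _ _ _ fun x hx => ?_
    have := h.distOn_add_le hp hx hy
    omega
  rw [sum_distOn] at h1
  have h2 : ∑ i ∈ S, (A.filter fun x => x i ≠ y i).card ≤
      ∑ i ∈ T, (A.filter fun x => x i ≠ y i).card :=
    Finset.sum_le_sum_of_subset (hS.trans (Finset.filter_subset _ _))
  -- Members of `A` agreeing with the center at `i` differ from `y` there. Over the s + 1
  -- coordinates of `S` the average distance to `y` is at least (s + 1)²/(s + 2) > s, a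
  -- contradiction.
  have h3 : ∀ i ∈ S, (s + 1) * A.card ≤ (s + 2) * (A.filter fun x => x i ≠ y i).card := by
    intro i hi
    obtain ⟨hiT, hne⟩ := Finset.mem_filter.1 (hS hi)
    have h4 := mul_card_filter_ne_le (hpT i hiT) (h.card_left i hiT)
    have h5 := Finset.card_filter_add_card_filter_not (s := A) (fun x => x i = x₀ i)
    have h6 : (A.filter fun x => x i = x₀ i).card ≤ (A.filter fun x => x i ≠ y i).card := by
      refine Finset.card_le_card fun x hx => ?_
      rw [Finset.mem_filter] at hx ⊢
      exact ⟨hx.1, by rw [hx.2]; exact hne.symm⟩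
    nlinarith
  have h4 := Finset.card_nsmul_le_sum S _ _ h3
  rw [← Finset.mul_sum, hScard, smul_eq_mul] at h4
  have := h.card_left_pos
  have h5 : (s + 1) * ((s + 1) * A.card) ≤ (s + 2) * (A.card * s) :=
    h4.trans (Nat.mul_le_mul_left _ (h2.trans h1))
  nlinarith

/-- If one family contains an element at the extreme distance from the center, then the other
one is obtained by fixing the coordinates in `T`. -/
lemma subset_hammingBall_zero (h : Concentrated r A B T x₀) (hp : ∀ i, 2 ≤ p i) {s : ℕ}
    (hs : s + r = T.card) (hpT : ∀ i ∈ T, s + 2 ≤ p i) {x : Vec p} (hx : x ∈ A)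
    (hxs : distOn T x x₀ = s) : B ⊆ hammingBall x₀ T 0 := by
  classical
  set S := T.filter fun i => x i ≠ x₀ i with hS
  have hST : S ⊆ T := Finset.filter_subset _ _
  -- Such a `y` spends all `s` permitted disagreements with `x` on `S`, so it equals `x`, hence
  -- `x₀`, on the rest of `T`.
  have hagree : (B.filter fun y => ∀ i ∈ S, y i = x₀ i) ⊆
      Finset.univ.filter fun y : Vec p => ∀ i ∈ T, y i = x₀ i := by
    intro y hy
    rw [Finset.mem_filter] at hy ⊢
    refine ⟨Finset.mem_univ _, fun i hi => ?_⟩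
    by_contra hne
    have hiS : i ∉ S := fun hiS => hne (hy.2 i hiS)
    have h1 : (insert i S).card ≤ distOn T x y := by
      refine Finset.card_le_card fun j hj => ?_
      rw [Finset.mem_filter]
      rcases Finset.mem_insert.1 hj with rfl | hj
      · refine ⟨hi, fun hxy => hiS ?_⟩
        rw [hS, Finset.mem_filter]
        exact ⟨hi, by rwa [hxy]⟩
      · refine ⟨hST hj, ?_⟩
        rw [hy.2 j hj]
        exact (Finset.mem_filter.1 hj).2
    rw [Finset.card_insert_of_notMem hiS] at h1
    have h2 := h.distOn_add_le hp hx hy.1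
    have h3 : S.card = s := hxs
    omega
  have h1 := card_le_card_agree_add B S x₀
  have h2 := Finset.card_le_card hagree
  rw [card_agree] at h2
  have h3 : (s + 2) * ∑ i ∈ S, (B.filter fun y => y i ≠ x₀ i).card ≤ s * B.card := by
    rw [Finset.mul_sum]
    refine (Finset.sum_le_card_nsmul S _ B.card fun i hi => ?_).trans_eq ?_
    · exact mul_card_filter_ne_le (hpT i (hST hi)) (h.card_right i (hST hi))
    · rw [smul_eq_mul]; congr 1
  intro y hy
  rw [mem_hammingBall, Nat.le_zero, distOn_eq_zero]
  intro i hi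
  by_contra hne
  -- A whole fiber over `T` deviates at `i`, so a fiber has size at most |B|/(s + 2); but the fiber
  -- over the center has at least 2|B|/(s + 2) elements.
  have h4 : (Finset.univ.filter fun z : Vec p => ∀ i ∈ T, z i = y i) ⊆
      B.filter fun z => z i ≠ x₀ i := by
    intro z hz
    rw [Finset.mem_filter] at hz ⊢
    exact ⟨mem_of_forall_irrelevant h.irrelevant_right hy hz.2, by rwa [hz.2 i hi]⟩
  have h5 := Finset.card_le_card h4
  rw [card_agree] at h5
  have h6 := mul_card_filter_ne_le (hpT i hi) (h.card_right i hi)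
  have h7 := h.symm.card_left_pos
  nlinarith

end Concentrated

/-! ### At most r + 3 relevant coordinates -/

/-- Balls of radius `2` are much larger than balls of radius `1`. -/
lemma card_hammingBall_one_le {T : Finset (Fin n)} (x₀ : Vec p) (hT : 4 ≤ T.card)
    (hpT : ∀ i ∈ T, 5 ≤ p i) :
    15 * (hammingBall x₀ T 1).card ≤ 4 * (hammingBall x₀ T 2).card := by
  classical
  set D := hammingBall x₀ T 1 with hD
  have h1 : ∑ i ∈ T, (D.filter fun x => x i ≠ x₀ i).card ≤ D.card := by
    rw [← sum_distOn]
    refine (Finset.sum_le_card_nsmul D _ 1 fun x hx => ?_).trans_eq (by simp)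
    exact mem_hammingBall.1 hx
  -- At least 3/4 of the ball agrees with the center at `j`; freeing `j` multiplies this by at least
  -- 5, giving the factor 15/4.
  obtain ⟨j, hj, hjle⟩ : ∃ j ∈ T, 4 * (D.filter fun x => x j ≠ x₀ j).card ≤ D.card := by
    by_contra! hcon
    have h2 := Finset.card_nsmul_le_sum T (fun i => 4 * (D.filter fun x => x i ≠ x₀ i).card)
      (D.card + 1) fun i hi => hcon i hi
    rw [← Finset.mul_sum, smul_eq_mul] at h2
    nlinarith
  have h2 : extendSlice j (x₀ j) D ⊆ hammingBall x₀ T 2 := by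
    intro x hx
    rw [mem_extendSlice, hD, mem_hammingBall] at hx
    rw [mem_hammingBall]
    have h3 := distOn_triangle T x (Function.update x j (x₀ j)) x₀
    have h4 : distOn T x (Function.update x j (x₀ j)) ≤ 1 := by
      unfold distOn
      rw [← Finset.card_singleton j]
      refine Finset.card_le_card fun i hi => ?_
      rw [Finset.mem_filter] at hi
      rw [Finset.mem_singleton]
      by_contra hij
      exact hi.2 (Function.update_of_ne hij _ _).symm
    omega
  have h3 := Finset.card_le_card h2
  rw [card_extendSlice] at h3
  have h4 := Finset.card_filter_add_card_filter_not (s := D) (fun x => x j = x₀ j)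
  have h5 := Nat.mul_le_mul_right (D.filter fun x => x j = x₀ j).card (hpT j hj)
  have h6 : (D.filter fun x => ¬ x j = x₀ j).card = (D.filter fun x => x j ≠ x₀ j).card := rfl
  omega

namespace Concentrated

variable {r : ℕ} {A B : Finset (Vec p)} {T : Finset (Fin n)} {x₀ : Vec p}

/-- At least 3/5 of `A` agrees with the center where `y` deviates. Those members already differ from
`y` twice, so they have at most one deviation left. -/
lemma card_le_of_distOn_eq_two (h : Concentrated r A B T x₀) (hp : ∀ i, 2 ≤ p i)
    (hs : 3 + r = T.card) (hpT : ∀ i ∈ T, 5 ≤ p i)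
    {y : Vec p} (hy : y ∈ B) (hy2 : distOn T y x₀ = 2) :
    3 * A.card ≤ 5 * (hammingBall x₀ T 1).card := by
  classical
  set S := T.filter fun i => y i ≠ x₀ i with hS
  have hST : S ⊆ T := Finset.filter_subset _ _
  have hScard : S.card = 2 := hy2
  have hagree : (A.filter fun x => ∀ i ∈ S, x i = x₀ i) ⊆ hammingBall x₀ T 1 := by
    intro x hx
    rw [Finset.mem_filter] at hx
    rw [mem_hammingBall]
    have h1 : (S ∪ T.filter fun i => x i ≠ x₀ i).card ≤ distOn T x y := by
      refine Finset.card_le_card fun j hj => ?_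
      rw [Finset.mem_filter]
      rcases Finset.mem_union.1 hj with hj | hj
      · refine ⟨hST hj, ?_⟩
        rw [hx.2 j hj]
        exact (Finset.mem_filter.1 hj).2.symm
      · obtain ⟨hjT, hj⟩ := Finset.mem_filter.1 hj
        refine ⟨hjT, fun hxy => ?_⟩
        exact hj (hx.2 j (Finset.mem_filter.2 ⟨hjT, by rwa [← hxy]⟩))
    rw [Finset.card_union_of_disjoint] at h1
    · have h2 := h.distOn_add_le hp hx.1 hy
      unfold distOn at *
      omega
    · rw [Finset.disjoint_left]
      intro j hj hj'
      exact (Finset.mem_filter.1 hj').2 (hx.2 j hj)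
  have h1 := card_le_card_agree_add A S x₀
  have h2 := Finset.card_le_card hagree
  have h3 : 5 * ∑ i ∈ S, (A.filter fun x => x i ≠ x₀ i).card ≤ 2 * A.card := by
    rw [Finset.mul_sum]
    refine (Finset.sum_le_card_nsmul S _ A.card fun i hi => ?_).trans_eq ?_
    · exact mul_card_filter_ne_le (hpT i (hST hi)) (h.card_left i (hST hi))
    · rw [smul_eq_mul, hScard]
  omega

/-- A maximal pair with at most `r + 3` relevant coordinates consists of concentric balls. -/
theorem exists_eq_hammingBall (h : Concentrated r A B T x₀) (hr : 1 ≤ r) (hp : ∀ i, 2 ≤ p i)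
    (hpT : ∀ i ∈ T, 5 ≤ p i) (hT : T.card ≤ r + 3) :
    ∃ a b, a + b + r = T.card ∧ A = hammingBall x₀ T a ∧ B = hammingBall x₀ T b := by
  obtain ⟨s, hs⟩ : ∃ s, s + r = T.card := ⟨T.card - r, by have := h.le_card hp; omega⟩
  have hs3 : s ≤ 3 := by omega
  have hpT' : ∀ i ∈ T, s + 2 ≤ p i := fun i hi => by have := hpT i hi; omega
  have hB := h.subset_hammingBall hp hs hpT'
  have hA := h.symm.subset_hammingBall hp hs hpT'
  by_cases hAs : ∃ x ∈ A, distOn T x x₀ = s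
  · obtain ⟨x, hx, hxs⟩ := hAs
    exact ⟨s, 0, by omega, h.eq_hammingBall (by omega) hA
      (h.subset_hammingBall_zero hp hs hpT' hx hxs)⟩
  by_cases hBs : ∃ x ∈ B, distOn T x x₀ = s
  · obtain ⟨x, hx, hxs⟩ := hBs
    exact ⟨0, s, by omega, h.eq_hammingBall (by omega)
      (h.symm.subset_hammingBall_zero hp hs hpT' hx hxs) hB⟩
  push Not at hAs hBs
  have shrink : ∀ (C : Finset (Vec p)) (k : ℕ), C ⊆ hammingBall x₀ T k →
      (∀ x ∈ C, distOn T x x₀ ≠ k) → C ⊆ hammingBall x₀ T (k - 1) := by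
    intro C k hC hne x hx
    have h1 := hne x hx
    have h2 := hC hx
    rw [mem_hammingBall] at h2 ⊢
    omega
  have hA1 := shrink A s hA hAs
  have hB1 := shrink B s hB hBs
  obtain rfl | rfl | rfl | rfl : s = 0 ∨ s = 1 ∨ s = 2 ∨ s = 3 := by omega
  · obtain ⟨x, hx⟩ := Finset.card_pos.1 h.card_left_pos
    have h1 := hAs x hx
    have h2 := mem_hammingBall.1 (hA hx)
    omega
  · exact ⟨0, 1, by omega, h.eq_hammingBall (by omega) hA1 hB⟩
  · exact ⟨1, 1, by omega, h.eq_hammingBall (by omega) hA1 hB1⟩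
  · by_cases hA2 : ∃ x ∈ A, distOn T x x₀ = 2
    · by_cases hB2 : ∃ x ∈ B, distOn T x x₀ = 2
      · exfalso
        obtain ⟨x, hx, hx2⟩ := hA2
        obtain ⟨y, hy, hy2⟩ := hB2
        have h1 := h.card_le_of_distOn_eq_two hp hs hpT hy hy2
        have h2 := h.symm.card_le_of_distOn_eq_two hp hs hpT hx hx2
        have h3 := card_hammingBall_one_le x₀ (by omega) hpT
        have h4 := h.isMaximalPair.2 _ _
          (crossIntersecting_hammingBall (T := T) (r := r) (a := 1) (b := 2) x₀ (by omega))
        have h5 := Nat.mul_le_mul h1 h2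
        have h6 : 0 < (hammingBall x₀ T 1).card :=
          Finset.card_pos.2 ⟨x₀, center_mem_hammingBall _ _ _⟩
        -- The product is at most 25/9 of the squared size of the 1-ball, while the balls of radii 1
        -- and 2 achieve at least 15/4 of it.
        nlinarith
      · push Not at hB2
        exact ⟨2, 1, by omega, h.eq_hammingBall (by omega) hA1 (shrink B 2 hB1 hB2)⟩
    · push Not at hA2
      exact ⟨1, 2, by omega, h.eq_hammingBall (by omega) (shrink A 2 hA1 hA2) hB1⟩

end Concentrated

lemma prod_compl_erase {W : Finset (Fin n)} {k : Fin n} (hk : k ∈ W) :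
    ∏ i ∈ (W.erase k)ᶜ, p i = p k * ∏ i ∈ Wᶜ, p i := by
  rw [Finset.compl_erase, Finset.prod_insert (by simpa using hk)]

lemma card_agree_ne {W : Finset (Fin n)} {k : Fin n} (hk : k ∈ W) (x₀ : Vec p) :
    (Finset.univ.filter fun x : Vec p => x k ≠ x₀ k ∧ ∀ i ∈ W.erase k, x i = x₀ i).card +
      ∏ i ∈ Wᶜ, p i = p k * ∏ i ∈ Wᶜ, p i := by
  classical
  rw [← prod_compl_erase hk, ← card_agree W x₀, ← card_agree (W.erase k) x₀,
    ← Finset.card_union_of_disjoint]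
  · congr 1
    ext x
    simp only [Finset.mem_union, Finset.mem_filter, Finset.mem_univ, true_and]
    constructor
    · rintro (h | h)
      · exact h.2
      · exact fun i hi => h i (Finset.mem_of_mem_erase hi)
    · intro h
      by_cases hx : x k = x₀ k
      · right
        intro i hi
        by_cases hik : i = k
        · rw [hik]; exact hx
        · exact h i (Finset.mem_erase.2 ⟨hik, hi⟩)
      · left; exact ⟨hx, h⟩
  · rw [Finset.disjoint_left]
    intro x hx hx'
    simp only [Finset.mem_filter, Finset.mem_univ, true_and] at hx hx'
    exact hx.1 (hx' k hk)

lemma card_filter_agree_le (A : Finset (Vec p)) (U : Finset (Fin n)) (x₀ : Vec p) :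
    (A.filter fun x => ∀ i ∈ U, x i = x₀ i).card ≤ ∏ i ∈ Uᶜ, p i := by
  rw [← card_agree U x₀]
  exact Finset.card_le_card (Finset.filter_subset_filter _ (Finset.subset_univ _))

lemma eq_of_distOn_le_one {T : Finset (Fin n)} {x y : Vec p} (h : distOn T x y ≤ 1)
    {i j : Fin n} (hi : i ∈ T) (hj : j ∈ T) (hij : i ≠ j) (hxi : x i ≠ y i) : x j = y j := by
  by_contra hxj
  exact hij (Finset.card_le_one.1 h i (Finset.mem_filter.2 ⟨hi, hxi⟩) j
    (Finset.mem_filter.2 ⟨hj, hxj⟩))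

/-! ### The case of large coordinates -/

namespace Concentrated

variable {r : ℕ} {A B : Finset (Vec p)} {T : Finset (Fin n)} {x₀ : Vec p}

/-- Each of the r + 1 coordinates excludes at most a 1/(r + 2) fraction of `A`. -/
lemma card_le_mul_card_agree (h : Concentrated r A B T x₀) (hp : ∀ i, r + 2 ≤ p i)
    {U : Finset (Fin n)} (hUT : U ⊆ T) (hU : U.card = r + 1) :
    A.card ≤ (r + 2) * (A.filter fun x => ∀ i ∈ U, x i = x₀ i).card := by
  have h1 := card_le_card_agree_add A U x₀
  have h2 : (r + 2) * ∑ i ∈ U, (A.filter fun x => x i ≠ x₀ i).card ≤ (r + 1) * A.card := by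
    rw [Finset.mul_sum, ← hU, ← smul_eq_mul]
    exact Finset.sum_le_card_nsmul U _ A.card fun i hi =>
      mul_card_filter_ne_le (hp i) (h.card_left i (hUT hi))
  nlinarith

/-- If there are more than `r` relevant coordinates, all bounds used for a set of `r + 1` of them
are tight. -/
lemma tight (h : Concentrated r A B T x₀) (hp : ∀ i, r + 2 ≤ p i)
    {U : Finset (Fin n)} (hUT : U ⊆ T) (hU : U.card = r + 1) :
    (∀ i ∈ U, p i = r + 2) ∧
    (∀ i ∈ U, (A.filter fun x => x i ≠ x₀ i).card = ∏ i ∈ Uᶜ, p i) ∧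
    ∀ x ∈ A, distOn U x x₀ ≤ 1 := by
  classical
  set Q := ∏ i ∈ Uᶜ, p i with hQ
  have hQ0 : 0 < Q := Finset.prod_pos fun i _ => by have := hp i; omega
  have hA1 := h.card_le_mul_card_agree hp hUT hU
  have hB1 := h.symm.card_le_mul_card_agree hp hUT hU
  have hA2 := card_filter_agree_le A U x₀
  have hB2 := card_filter_agree_le B U x₀
  rw [← hQ] at hA2 hB2
  have hA3 : A.card ≤ (r + 2) * Q := hA1.trans (Nat.mul_le_mul_left _ hA2)
  have hB3 : B.card ≤ (r + 2) * Q := hB1.trans (Nat.mul_le_mul_left _ hB2)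
  -- Fixing `U` without `j` is the competitor that meets the upper bound ((r + 2)Q)².
  have hlow : ∀ j ∈ U, p j * Q * (p j * Q) ≤ A.card * B.card := by
    intro j hj
    have := h.isMaximalPair.prod_le (fun i => by have := hp i; omega) (R := U.erase j)
      (by rw [Finset.card_erase_of_mem hj, hU]; rfl)
    rwa [prod_compl_erase hj] at this
  have hpU : ∀ i ∈ U, p i = r + 2 := by
    intro j hj
    refine le_antisymm ?_ (hp j)
    have h1 := (hlow j hj).trans (Nat.mul_le_mul hA3 hB3)
    exact Nat.le_of_mul_le_mul_right (Nat.mul_self_le_mul_self_iff.1 h1) hQ0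
  obtain ⟨j, hj⟩ : U.Nonempty := Finset.card_pos.1 (by omega)
  have hAcard : A.card = (r + 2) * Q := by
    refine le_antisymm hA3 ?_
    have h1 := hlow j hj
    rw [hpU j hj] at h1
    have h2 := h1.trans (Nat.mul_le_mul_left _ hB3)
    exact Nat.le_of_mul_le_mul_right h2 (by positivity)
  have hagree : (A.filter fun x => ∀ i ∈ U, x i = x₀ i).card = Q := by
    refine le_antisymm hA2 ?_
    rw [hAcard] at hA1
    exact Nat.le_of_mul_le_mul_left hA1 (by omega)
  have hle : ∀ i ∈ U, (A.filter fun x => x i ≠ x₀ i).card ≤ Q := by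
    intro i hi
    have h1 := mul_card_filter_ne_le (hp i) (h.card_left i (hUT hi))
    rw [hAcard] at h1
    exact Nat.le_of_mul_le_mul_left h1 (by omega)
  have hsum : ∑ i ∈ U, (A.filter fun x => x i ≠ x₀ i).card = ∑ i ∈ U, Q := by
    refine le_antisymm (Finset.sum_le_sum hle) ?_
    rw [Finset.sum_const, hU, smul_eq_mul]
    have h1 := card_le_card_agree_add A U x₀
    rw [hagree, hAcard] at h1
    nlinarith
  have heq := (Finset.sum_eq_sum_iff_of_le hle).1 hsum
  refine ⟨hpU, heq, ?_⟩
  -- Equality in the union bound: the sets of deviating vectors are disjoint.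
  have hsum' : ∑ x ∈ A, (if ∀ i ∈ U, x i = x₀ i then 0 else 1) = ∑ x ∈ A, distOn U x x₀ := by
    rw [sum_distOn, hsum, Finset.sum_const, hU, smul_eq_mul]
    have h1 := Finset.card_filter_add_card_filter_not (s := A) (fun x => ∀ i ∈ U, x i = x₀ i)
    rw [hagree, hAcard] at h1
    rw [Finset.sum_ite, Finset.sum_const_zero, zero_add, Finset.sum_const, smul_eq_mul, mul_one]
    nlinarith
  have hpt := (Finset.sum_eq_sum_iff_of_le (s := A) (fun x _ => by
    split_ifs with hx
    · exact Nat.zero_le _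
    · rw [Nat.one_le_iff_ne_zero]
      exact fun h0 => hx (distOn_eq_zero.1 h0))).1 hsum'
  intro x hx
  rw [← hpt x hx]
  split_ifs <;> omega

theorem card_eq_of_le (h : Concentrated r A B T x₀) (hr : 1 ≤ r) (hp : ∀ i, r + 2 ≤ p i) :
    T.card = r := by
  classical
  have hp2 : ∀ i, 2 ≤ p i := fun i => by have := hp i; omega
  refine le_antisymm ?_ (h.le_card hp2)
  by_contra! hlt
  rcases (Nat.succ_le_of_lt hlt).eq_or_lt with heq | hlt'
  · obtain ⟨-, hA1, hA2⟩ := h.tight hp subset_rfl heq.symm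
    obtain ⟨-, hB1, hB2⟩ := h.symm.tight hp subset_rfl heq.symm
    -- A member of `A` deviating only at `i` and one of `B` deviating only at `j` differ twice, but
    -- only one difference is allowed.
    obtain ⟨i, hi, j, hj, hij⟩ := Finset.one_lt_card.1 (show 1 < T.card by omega)
    have hQ0 : 0 < ∏ i ∈ Tᶜ, p i := Finset.prod_pos fun i _ => by have := hp i; omega
    obtain ⟨x, hx⟩ := Finset.card_pos.1 (hA1 i hi ▸ hQ0)
    obtain ⟨y, hy⟩ := Finset.card_pos.1 (hB1 j hj ▸ hQ0)
    rw [Finset.mem_filter] at hx hy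
    have h1 : distOn T x y ≤ 1 := by
      have := h.distOn_add_le hp2 hx.1 hy.1
      omega
    have hyi := eq_of_distOn_le_one (hB2 y hy.1) hj hi hij.symm hy.2
    have hxj := eq_of_distOn_le_one (hA2 x hx.1) hi hj hij hx.2
    have := eq_of_distOn_le_one h1 hi hj hij (by rw [hyi]; exact hx.2)
    exact hy.2 (this ▸ hxj)
  · obtain ⟨V, hVT, hV⟩ := Finset.exists_subset_card_eq (s := T) (n := r + 1) hlt
    obtain ⟨k, hkV⟩ : V.Nonempty := Finset.card_pos.1 (by omega)
    obtain ⟨k', hk'T, hk'V⟩ := Finset.exists_mem_notMem_of_card_lt_card (s := V) (t := T)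
      (by omega)
    have hpair : ∀ j ∈ T, j ≠ k → ∀ x ∈ A, x k ≠ x₀ k → x j = x₀ j := by
      intro j hj hjk x hx hxk
      obtain ⟨U, hsub, hUT, hU⟩ := Finset.exists_subsuperset_card_eq (s := {k, j}) (t := T)
        (n := r + 1) (by
          intro i hi
          rcases Finset.mem_insert.1 hi with rfl | hi
          · exact hVT hkV
          · rwa [Finset.mem_singleton.1 hi]) (Finset.card_le_two.trans (by omega)) hlt
      exact eq_of_distOn_le_one ((h.tight hp hUT hU).2.2 x hx) (hsub (by simp)) (hsub (by simp))
        hjk.symm hxk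
    set W := insert k' V with hW
    have hkW : k ∈ W := Finset.mem_insert_of_mem hkV
    have hWT : W ⊆ T := Finset.insert_subset hk'T hVT
    have h1 := (h.tight hp hVT hV).2.1 k hkV
    -- Deviating at `k` pins the other r + 1 coordinates of `W`, leaving p_k - 1 choices on `W`;
    -- tightness on `V` demands p_{k'} = p_k of them.
    have h2 : (A.filter fun x => x k ≠ x₀ k) ⊆
        Finset.univ.filter fun x : Vec p => x k ≠ x₀ k ∧ ∀ i ∈ W.erase k, x i = x₀ i := by
      intro x hx
      rw [Finset.mem_filter] at hx ⊢
      refine ⟨Finset.mem_univ _, hx.2, fun i hi => ?_⟩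
      exact hpair i (hWT (Finset.mem_of_mem_erase hi)) (Finset.ne_of_mem_erase hi) x hx.1 hx.2
    have h3 := Finset.card_le_card h2
    have h4 := card_agree_ne hkW x₀
    have h5 : ∏ i ∈ Vᶜ, p i = p k' * ∏ i ∈ Wᶜ, p i := by
      rw [← prod_compl_erase (Finset.mem_insert_self k' V), Finset.erase_insert hk'V]
    have h6 : p k = r + 2 := (h.tight hp hVT hV).1 k hkV
    have h7 : p k' = r + 2 := by
      obtain ⟨U, hsub, hUT, hU⟩ := Finset.exists_subsuperset_card_eq (s := {k'}) (t := T)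
        (n := r + 1) (by simpa using hk'T) (by simp) hlt
      exact (h.tight hp hUT hU).1 k' (hsub (by simp))
    have hQ0 : 0 < ∏ i ∈ Wᶜ, p i := Finset.prod_pos fun i _ => by have := hp i; omega
    rw [h1, h5, h7, ← h6] at h3
    omega

end Concentrated

/-- Fixing coordinates of smallest size leaves the most vectors. -/
lemma prod_compl_le_prod_filter (hp : Monotone p) {r : ℕ} {R : Finset (Fin n)}
    (hR : R.card = r) :
    ∏ i ∈ Rᶜ, p i ≤ ∏ i ∈ Finset.univ.filter (fun i : Fin n => r ≤ i.val), p i := by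
  classical
  set F := Finset.univ.filter (fun i : Fin n => r ≤ i.val) with hF
  have hrn : r ≤ n := by simpa [hR] using Finset.card_le_univ R
  have hcard : Rᶜ.card = F.card := by
    have h1 : (Finset.univ.filter fun i : Fin n => i.val < r).card = r := by
      rw [Fin.card_filter_val_lt]; omega
    have h2 := Finset.card_filter_add_card_filter_not (s := (Finset.univ : Finset (Fin n)))
      (fun i => i.val < r)
    simp only [not_lt, Finset.card_univ, Fintype.card_fin] at h2
    rw [Finset.card_compl, Fintype.card_fin, hR, hF]
    omega
  rw [← Finset.prod_inter_mul_prod_sdiff Rᶜ F, ← Finset.prod_inter_mul_prod_sdiff F Rᶜ,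
    Finset.inter_comm F]
  refine Nat.mul_le_mul_left _ ?_
  have hd : (Rᶜ \ F).card = (F \ Rᶜ).card := by
    have h1 := Finset.card_sdiff_add_card_inter Rᶜ F
    have h2 := Finset.card_sdiff_add_card_inter F Rᶜ
    rw [Finset.inter_comm] at h2
    omega
  -- After cancelling common factors, the left indices are below `r` and the right ones are not; `p
  -- j` separates the factors.
  rcases (Rᶜ \ F).eq_empty_or_nonempty with he | hne
  · rw [he, Finset.card_empty, eq_comm, Finset.card_eq_zero] at hd
    rw [he, hd]
  · obtain ⟨j, hj, hmax⟩ := Finset.exists_max_image _ p hne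
    refine (Finset.prod_le_pow_card _ p (p j) hmax).trans ?_
    rw [hd]
    refine Finset.pow_card_le_prod _ p (p j) fun i hi => hp ?_
    simp only [hF, Finset.mem_sdiff, Finset.mem_filter, Finset.mem_univ, true_and, not_le] at hi hj
    exact Fin.le_def.2 (by omega)

/-! ### Bounding the number of relevant coordinates -/

/-- Gibbs' inequality for the uniform distribution on `A` and a product distribution. -/
lemma card_mul_log_card_le {A : Finset (Vec p)} (hA : A.Nonempty) (f : ∀ i, Fin (p i) → ℝ)
    (hf : ∀ i, ∑ v, Real.exp (-f i v) = 1) :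
    A.card * Real.log A.card ≤ ∑ x ∈ A, ∑ i, f i (x i) := by
  have hA0 : (0 : ℝ) < A.card := by exact_mod_cast hA.card_pos
  have htot : ∑ x : Vec p, Real.exp (-∑ i, f i (x i)) = 1 := by
    have h1 := Finset.prod_univ_sum (fun i => (Finset.univ : Finset (Fin (p i))))
      fun i v => Real.exp (-f i v)
    rw [Fintype.piFinset_univ, Finset.prod_congr rfl fun i _ => hf i, Finset.prod_const_one] at h1
    rw [h1]
    refine Finset.sum_congr rfl fun x _ => ?_
    rw [← Real.exp_sum, Finset.sum_neg_distrib]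
  have hle : ∑ x ∈ A, Real.exp (-∑ i, f i (x i)) ≤ 1 := by
    rw [← htot]
    exact Finset.sum_le_sum_of_subset_of_nonneg (Finset.subset_univ _)
      fun _ _ _ => (Real.exp_pos _).le
  have hpt : ∀ x ∈ A, Real.log A.card - ∑ i, f i (x i) ≤
      A.card * Real.exp (-∑ i, f i (x i)) - 1 := by
    intro x _
    have := Real.log_le_sub_one_of_pos (mul_pos hA0 (Real.exp_pos (-∑ i, f i (x i))))
    rwa [Real.log_mul hA0.ne' (Real.exp_pos _).ne', Real.log_exp] at this
  have hs := Finset.sum_le_sum hpt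
  rw [Finset.sum_sub_distrib, Finset.sum_sub_distrib, ← Finset.mul_sum, Finset.sum_const,
    Finset.sum_const, nsmul_eq_mul, nsmul_eq_mul, mul_one] at hs
  nlinarith

/-- Gibbs' inequality against the product measure that on `T` gives the center value mass 1 - 1/p_i
and splits the rest evenly, and is uniform elsewhere; `g` is the correction to the uniform cost log
p_i. -/
lemma log_card_le {A : Finset (Vec p)} (hA : A.Nonempty) {T : Finset (Fin n)} {x₀ : Vec p}
    (hp : ∀ i, 2 ≤ p i)
    (hT : ∀ i ∈ T, p i * (A.filter fun x => x i ≠ x₀ i).card ≤ A.card) :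
    Real.log A.card ≤ ∑ i, Real.log (p i) - ∑ i ∈ T, (1 - 2 / (p i : ℝ)) * Real.log (p i - 1) := by
  classical
  have hA0 : (0 : ℝ) < A.card := by exact_mod_cast hA.card_pos
  have hp' : ∀ i, (2 : ℝ) ≤ p i := fun i => by exact_mod_cast hp i
  let g : ∀ i, Fin (p i) → ℝ := fun i v =>
    if i ∈ T then (if v = x₀ i then -Real.log (p i - 1) else Real.log (p i - 1)) else 0
  have h1 := card_mul_log_card_le hA (fun i v => Real.log (p i) + g i v) (by
    intro i
    have hpi := hp' i
    have hpi0 : (0 : ℝ) < p i := by linarith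
    have hpi1 : (0 : ℝ) < p i - 1 := by linarith
    simp only [neg_add, Real.exp_add, ← Finset.mul_sum, Real.exp_neg (Real.log _),
      Real.exp_log hpi0]
    by_cases hi : i ∈ T
    · rw [← Finset.add_sum_erase _ _ (Finset.mem_univ (x₀ i))]
      have : ∀ v ∈ Finset.univ.erase (x₀ i), Real.exp (-g i v) = ((p i : ℝ) - 1)⁻¹ := by
        intro v hv
        simp only [g, if_pos hi, if_neg (Finset.ne_of_mem_erase hv), Real.exp_neg,
          Real.exp_log hpi1]
      rw [Finset.sum_congr rfl this, Finset.sum_const,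
        Finset.card_erase_of_mem (Finset.mem_univ _), Finset.card_univ, Fintype.card_fin,
        nsmul_eq_mul, Nat.cast_sub (by have := hp i; omega), Nat.cast_one,
        mul_inv_cancel₀ hpi1.ne']
      simp only [g, if_pos hi, if_true, neg_neg, Real.exp_log hpi1]
      rw [sub_add_cancel, inv_mul_cancel₀ hpi0.ne']
    · simp [g, hi, hpi0.ne'])
  simp only [Finset.sum_add_distrib] at h1
  rw [Finset.sum_const, nsmul_eq_mul, Finset.sum_comm] at h1
  have h2 : ∑ i, ∑ x ∈ A, g i (x i) ≤
      ∑ i ∈ T, -(A.card * ((1 - 2 / (p i : ℝ)) * Real.log (p i - 1))) := by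
    rw [← Finset.sum_subset (Finset.subset_univ T) (fun i _ hi => by simp [g, hi])]
    refine Finset.sum_le_sum fun i hi => ?_
    have hpi := hp' i
    have hL : 0 ≤ Real.log ((p i : ℝ) - 1) := Real.log_nonneg (by linarith)
    simp only [g, if_pos hi]
    rw [Finset.sum_ite, Finset.sum_const, Finset.sum_const, nsmul_eq_mul, nsmul_eq_mul]
    have h3 : ((A.filter fun x => x i = x₀ i).card : ℝ) + (A.filter fun x => ¬ x i = x₀ i).card
        = A.card := by
      exact_mod_cast Finset.card_filter_add_card_filter_not (s := A) (fun x => x i = x₀ i)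
    have h4 : ((A.filter fun x => ¬ x i = x₀ i).card : ℝ) ≤ A.card / p i := by
      rw [le_div_iff₀ (by linarith), mul_comm]
      exact_mod_cast hT i hi
    have h5 : (A.card : ℝ) * ((1 - 2 / (p i : ℝ)) * Real.log (p i - 1)) =
        (A.card - 2 * (A.card / p i)) * Real.log (p i - 1) := by ring
    rw [h5]
    nlinarith
  rw [Finset.sum_neg_distrib, ← Finset.mul_sum] at h2
  refine le_of_mul_le_mul_left ?_ hA0
  linarith

/-- Among the `r`-element subsets of `T` there is one with at most average sum. -/
lemma exists_subset_sum_le (f : Fin n → ℝ) (r d : ℕ) (hr : 1 ≤ r) :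
    ∀ T : Finset (Fin n), T.card = r + d →
    ∃ R ⊆ T, R.card = r ∧ T.card * ∑ i ∈ R, f i ≤ r * ∑ i ∈ T, f i := by
  induction d with
  | zero => intro T hT; exact ⟨T, subset_rfl, hT, by rw [hT]; simp⟩
  | succ d ih =>
    intro T hT
    obtain ⟨m, hm, hmax⟩ := Finset.exists_max_image T f (Finset.card_pos.1 (by omega))
    have hcard : (T.erase m).card = r + d := by rw [Finset.card_erase_of_mem hm]; omega
    obtain ⟨R, hRT, hR, hle⟩ := ih (T.erase m) hcard
    refine ⟨R, hRT.trans (Finset.erase_subset _ _), hR, ?_⟩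
    rw [hcard] at hle
    rw [hT, ← Finset.add_sum_erase _ _ hm]
    have h1 := Finset.sum_le_card_nsmul (T.erase m) f (f m)
      fun i hi => hmax i (Finset.mem_of_mem_erase hi)
    rw [hcard, nsmul_eq_mul] at h1
    push_cast at *
    have hr' : (1 : ℝ) ≤ r := by exact_mod_cast hr
    have hd : (0 : ℝ) ≤ d := by positivity
    refine le_of_mul_le_mul_left ?_ (show (0 : ℝ) < r + d by linarith)
    nlinarith [mul_le_mul_of_nonneg_left h1 (show (0 : ℝ) ≤ r by linarith),
      mul_le_mul_of_nonneg_left hle (show (0 : ℝ) ≤ r + d + 1 by linarith)]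

/-- Compare with fixing `r` coordinates of `T` of at most average log-size: the entropy saving
summed over `T` cannot exceed r/|T| times the sum of log p_i over `T`, which fails once |T| ≥ r + 4.
-/
lemma Concentrated.card_le {r : ℕ} {A B : Finset (Vec p)} {T : Finset (Fin n)} {x₀ : Vec p}
    (h : Concentrated r A B T x₀) (hr : 1 ≤ r) (hp : ∀ i, 2 ≤ p i)
    (hlog : ∀ i ∈ T,
      r * Real.log (p i) < (r + 4) * ((1 - 2 / (p i : ℝ)) * Real.log (p i - 1))) :
    T.card ≤ r + 3 := by
  classical
  by_contra! hlt
  obtain ⟨R, hRT, hR, hle⟩ := exists_subset_sum_le (fun i => Real.log (p i)) r (T.card - r) hr T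
    (by omega)
  have hlogp : ∀ i, 0 ≤ Real.log (p i) := fun i => Real.log_natCast_nonneg _
  have hA := log_card_le (Finset.card_pos.1 h.card_left_pos) hp h.card_left
  have hB := log_card_le (Finset.card_pos.1 h.symm.card_left_pos) hp h.card_right
  have hA0 : (A.card : ℝ) ≠ 0 := by exact_mod_cast h.card_left_pos.ne'
  have hB0 : (B.card : ℝ) ≠ 0 := by exact_mod_cast h.symm.card_left_pos.ne'
  have hlow : 2 * ∑ i ∈ Rᶜ, Real.log (p i) ≤ Real.log A.card + Real.log B.card := by
    have h1 := h.isMaximalPair.prod_le (fun i => by have := hp i; omega) hR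
    have hne : ∀ i ∈ Rᶜ, (p i : ℝ) ≠ 0 := fun i _ => by have := hp i; positivity
    rw [← Real.log_mul hA0 hB0, ← Real.log_prod hne, two_mul,
      ← Real.log_mul (Finset.prod_ne_zero_iff.2 hne) (Finset.prod_ne_zero_iff.2 hne)]
    refine Real.log_le_log ?_ (by exact_mod_cast h1)
    have : 0 < ∏ i ∈ Rᶜ, (p i : ℝ) :=
      Finset.prod_pos fun i _ => by have := hp i; positivity
    positivity
  have hsplit := Finset.sum_add_sum_compl R fun i => Real.log (p i : ℝ)
  have hlt' := Finset.sum_lt_sum_of_nonempty (Finset.card_pos.1 (by omega : 0 < T.card)) hlog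
  rw [← Finset.mul_sum, ← Finset.mul_sum] at hlt'
  have hR0 : 0 ≤ ∑ i ∈ R, Real.log (p i) := Finset.sum_nonneg fun i _ => hlogp i
  have hT4 : (r + 4 : ℝ) ≤ T.card := by exact_mod_cast hlt
  nlinarith [mul_le_mul_of_nonneg_right hT4 hR0]

/-- Replacing log q by log(q - 1) + 1/(q - 1) leaves the coefficient 4q - 2r - 8, positive for q >
r/2 + 2: the origin of the r/2 in the threshold. -/
lemma mul_log_lt {r q : ℝ} (hr : 0 ≤ r) (hq : 2 ≤ q)
    (h : r * (q / (q - 1)) < (4 * q - 2 * r - 8) * Real.log (q - 1)) :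
    r * Real.log q < (r + 4) * ((1 - 2 / q) * Real.log (q - 1)) := by
  have hq0 : 0 < q := by linarith
  have hq1 : 0 < q - 1 := by linarith
  have h1 : Real.log q ≤ Real.log (q - 1) + 1 / (q - 1) := by
    have h2 := Real.log_le_sub_one_of_pos (div_pos hq0 hq1)
    rw [Real.log_div hq0.ne' hq1.ne'] at h2
    have h3 : q / (q - 1) - 1 = 1 / (q - 1) := by field_simp; ring
    linarith
  refine lt_of_mul_lt_mul_left ?_ hq0.le
  calc q * (r * Real.log q) = r * q * Real.log q := by ring
    _ ≤ r * q * (Real.log (q - 1) + 1 / (q - 1)) := by gcongr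
    _ = r * q * Real.log (q - 1) + r * (q / (q - 1)) := by ring
    _ < r * q * Real.log (q - 1) + (4 * q - 2 * r - 8) * Real.log (q - 1) := by linarith
    _ = q * ((r + 4) * ((1 - 2 / q) * Real.log (q - 1))) := by field_simp; ring

lemma mul_log_lt_of_add_one_le {r q : ℝ} (hr : 4 ≤ r) (hq : r + 1 ≤ q) :
    r * Real.log q < (r + 4) * ((1 - 2 / q) * Real.log (q - 1)) := by
  refine mul_log_lt (by linarith) (by linarith) ?_
  -- A lower bound for log 4; what remains is 1.386(2q - 6) > q, valid for q ≥ 5.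
  have hL : 1.386 < Real.log (q - 1) := by
    have h1 : Real.log 4 ≤ Real.log (q - 1) := Real.log_le_log (by norm_num) (by linarith)
    have h2 : Real.log 4 = 2 * Real.log 2 := by
      rw [← Real.log_rpow (by norm_num)]; norm_num
    linarith [Real.log_two_gt_d9]
  have h1 : r * (q / (q - 1)) ≤ q := by
    rw [← mul_div_assoc, div_le_iff₀ (by linarith)]
    nlinarith
  nlinarith

/-- The term r/log(r + 3) contributes 2r on the right, since log(q - 1) ≥ log(r + 3)/2, and this
absorbs the error r·q/(q - 1) ≤ 2r. -/
lemma mul_log_lt_of_threshold_le {r q : ℝ} (hr : 1 ≤ r)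
    (hq : r / 2 + 5 + r / Real.log (r + 3) ≤ q) :
    r * Real.log q < (r + 4) * ((1 - 2 / q) * Real.log (q - 1)) := by
  have hl : 0 < Real.log (r + 3) := Real.log_pos (by linarith)
  have hd : 0 < r / Real.log (r + 3) := by positivity
  refine mul_log_lt (by linarith) (by linarith) ?_
  have hL : Real.log (r + 3) / 2 ≤ Real.log (q - 1) := by
    have h1 : Real.log (r + 3) ≤ Real.log ((q - 1) ^ 2) :=
      Real.log_le_log (by linarith) (by nlinarith)
    rw [Real.log_pow] at h1
    push_cast at h1
    linarith
  have h1 : r * (q / (q - 1)) ≤ r * 2 := by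
    gcongr
    rw [div_le_iff₀ (by linarith)]
    linarith
  have h2 : 4 * (r / Real.log (r + 3)) * (Real.log (r + 3) / 2) = r * 2 := by
    field_simp; norm_num
  have h3 : 4 * (r / Real.log (r + 3)) + 12 ≤ 4 * q - 2 * r - 8 := by linarith
  calc r * (q / (q - 1)) ≤ 4 * (r / Real.log (r + 3)) * (Real.log (r + 3) / 2) := by
        rw [h2]; exact h1
    _ < (4 * (r / Real.log (r + 3)) + 12) * (Real.log (r + 3) / 2) := by nlinarith
    _ ≤ (4 * q - 2 * r - 8) * Real.log (q - 1) :=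
        mul_le_mul h3 hL (by positivity) (by linarith)

lemma isLittleO_threshold :
    (fun r : ℕ => ((r : ℝ) / 2 + 5 + r / Real.log (r + 3)) - (r : ℝ) / 2)
      =o[atTop] (fun r : ℕ => (r : ℝ)) := by
  have h1 : Tendsto (fun r : ℕ => (5 : ℝ) / r + (Real.log (r + 3))⁻¹) atTop (nhds 0) := by
    rw [← add_zero (0 : ℝ)]
    refine (tendsto_const_nhds.div_atTop tendsto_natCast_atTop_atTop).add ?_
    exact (Real.tendsto_log_atTop.comp
      (tendsto_natCast_atTop_atTop.atTop_add tendsto_const_nhds)).inv_tendsto_atTop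
  have hne : ∀ᶠ r : ℕ in atTop, (r : ℝ) ≠ 0 := by
    filter_upwards [eventually_ge_atTop 1] with r hr
    positivity
  rw [isLittleO_iff_tendsto' (hne.mono fun r hr h0 => absurd h0 hr)]
  refine h1.congr' ?_
  filter_upwards [hne] with r hr
  field_simp
  ring

/-! ### The case of coordinates of size at least `r + 1` -/

lemma card_hammingBall_one_le_mul_sum (T : Finset (Fin n)) (x₀ : Vec p) (hp : ∀ i, 1 ≤ p i) :
    (hammingBall x₀ T 1).card ≤ (∏ i ∈ Tᶜ, p i) * (1 + ∑ i ∈ T, (p i - 1)) := by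
  classical
  set D := hammingBall x₀ T 1 with hD
  refine (card_le_card_agree_add D T x₀).trans ?_
  rw [mul_add, mul_one, Finset.mul_sum]
  refine Nat.add_le_add (card_filter_agree_le D T x₀)
    (Finset.sum_le_sum fun k hk => ?_)
  have h1 := card_agree_ne hk x₀
  have h2 : (D.filter fun x => x k ≠ x₀ k) ⊆
      Finset.univ.filter fun x : Vec p => x k ≠ x₀ k ∧ ∀ i ∈ T.erase k, x i = x₀ i := by
    intro x hx
    rw [Finset.mem_filter] at hx ⊢
    refine ⟨Finset.mem_univ _, hx.2, fun i hi => ?_⟩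
    exact eq_of_distOn_le_one (mem_hammingBall.1 hx.1) hk (Finset.mem_of_mem_erase hi)
      (Finset.ne_of_mem_erase hi).symm hx.2
  have h3 := Finset.card_le_card h2
  obtain ⟨q, hq⟩ : ∃ q, p k = q + 1 := ⟨p k - 1, by have := hp k; omega⟩
  have h4 : p k * ∏ i ∈ Tᶜ, p i = (∏ i ∈ Tᶜ, p i) * (p k - 1) + ∏ i ∈ Tᶜ, p i := by
    rw [hq]; simp; ring
  omega

namespace Concentrated

variable {r : ℕ} {A B : Finset (Vec p)} {T : Finset (Fin n)} {x₀ : Vec p}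

/-- The mean distance to the center is at most (r + 3)/(r + 1) ≤ 7/5, so at least 3/10 of `A` lies
in the 1-ball; a radius of 2 or more would allow at most 4/15. -/
lemma radius_le_one (h : Concentrated r A B T x₀) (hr : 4 ≤ r) (hp : ∀ i, r + 1 ≤ p i)
    (hT : T.card ≤ r + 3) {a : ℕ} (hA : A = hammingBall x₀ T a) : a ≤ 1 := by
  classical
  by_contra! ha
  have hTr := h.le_card fun i => by have := hp i; omega
  have h1 : ∑ x ∈ A, distOn T x x₀ = ∑ i ∈ T, (A.filter fun x => x i ≠ x₀ i).card :=
    sum_distOn T A x₀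
  have h2 : (r + 1) * ∑ i ∈ T, (A.filter fun x => x i ≠ x₀ i).card ≤ T.card * A.card := by
    rw [Finset.mul_sum, ← smul_eq_mul T.card]
    exact Finset.sum_le_card_nsmul T _ A.card fun i hi =>
      mul_card_filter_ne_le (hp i) (h.card_left i hi)
  have h3 : 5 * ∑ x ∈ A, distOn T x x₀ ≤ 7 * A.card := by
    rw [← h1] at h2
    have h4 : T.card * A.card ≤ (r + 3) * A.card := Nat.mul_le_mul_right _ hT
    have h5 : 5 * (r + 3) * A.card ≤ 7 * (r + 1) * A.card := Nat.mul_le_mul_right _ (by omega)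
    refine le_of_mul_le_mul_left (a := r + 1) ?_ (by omega)
    nlinarith
  have h4 : 2 * (A.filter fun x => ¬ distOn T x x₀ ≤ 1).card ≤ ∑ x ∈ A, distOn T x x₀ := by
    rw [mul_comm, ← smul_eq_mul]
    refine (Finset.card_nsmul_le_sum _ (fun x => distOn T x x₀) 2 fun x hx => ?_).trans
      (Finset.sum_le_sum_of_subset (Finset.filter_subset _ _))
    have := (Finset.mem_filter.1 hx).2
    omega
  have h5 := Finset.card_filter_add_card_filter_not (s := A) (fun x => distOn T x x₀ ≤ 1)
  have h6 : (A.filter fun x => distOn T x x₀ ≤ 1).card ≤ (hammingBall x₀ T 1).card :=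
    Finset.card_le_card fun x hx => mem_hammingBall.2 (Finset.mem_filter.1 hx).2
  have h7 := card_hammingBall_one_le x₀ (by omega) fun i (_ : i ∈ T) => by
    have := hp i; omega
  have h8 : (hammingBall x₀ T 2).card ≤ A.card := by
    rw [hA]; exact Finset.card_le_card (hammingBall_mono _ _ ha)
  have h9 : 0 < (hammingBall x₀ T 1).card :=
    Finset.card_pos.2 ⟨x₀, center_mem_hammingBall _ _ _⟩
  omega

/-- Freeing the largest coordinate of `T` beats this pair: with q = p_k - 1 ≥ r, (q + 1)² > 1 + (r +
1)q. -/
lemma not_radius_zero_one (h : Concentrated r A B T x₀) (hr : 1 ≤ r)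
    (hp : ∀ i, r + 1 ≤ p i) (hT : T.card = r + 1) (hA : A = hammingBall x₀ T 0)
    (hB : B = hammingBall x₀ T 1) : False := by
  classical
  have hp0 : ∀ i, 0 < p i := fun i => by have := hp i; omega
  set M := ∏ i ∈ Tᶜ, p i with hM
  have hM0 : 0 < M := Finset.prod_pos fun i _ => hp0 i
  obtain ⟨k, hk, hmax⟩ := Finset.exists_max_image T p (Finset.card_pos.1 (by omega))
  have h1 := h.isMaximalPair.prod_le hp0 (R := T.erase k)
    (by rw [Finset.card_erase_of_mem hk, hT]; rfl)
  rw [prod_compl_erase hk, ← hM, hA, hB, card_hammingBall_zero, ← hM] at h1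
  have h2 := card_hammingBall_one_le_mul_sum T x₀ hp0
  rw [← hM] at h2
  have h3 : ∑ i ∈ T, (p i - 1) ≤ (r + 1) * (p k - 1) := by
    rw [← hT, ← smul_eq_mul]
    exact Finset.sum_le_card_nsmul _ _ _ fun i hi => Nat.sub_le_sub_right (hmax i hi) 1
  have h4 : p k * M * (p k * M) ≤ M * (M * (1 + (r + 1) * (p k - 1))) :=
    h1.trans (Nat.mul_le_mul_left _ (h2.trans (Nat.mul_le_mul_left _ (by omega))))
  have h5 : p k * p k ≤ 1 + (r + 1) * (p k - 1) := by
    refine le_of_mul_le_mul_left (a := M * M) ?_ (by positivity)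
    calc M * M * (p k * p k) = p k * M * (p k * M) := by ring
      _ ≤ _ := h4
      _ = _ := by ring
  obtain ⟨q, hq⟩ : ∃ q, p k = q + 1 := ⟨p k - 1, by have := hp0 k; omega⟩
  have h6 := hp k
  rw [hq] at h5 h6
  simp only [Nat.add_sub_cancel] at h5
  have hq0 : 0 < q := by omega
  nlinarith

/-- Freeing the two largest coordinates of `T` does strictly better unless the largest is r + 1;
then the sizes agree, as 1 + (r + 2)r = (r + 1)². -/
lemma eq_of_radius_one_one (h : Concentrated r A B T x₀) (hr : 1 ≤ r) (hp : ∀ i, r + 1 ≤ p i)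
    (hT : T.card = r + 2) (hA : A = hammingBall x₀ T 1) (hB : B = hammingBall x₀ T 1) :
    (∀ i ∈ T, p i = r + 1) ∧ ∃ R : Finset (Fin n), R.card = r ∧
      A.card * B.card ≤ (∏ i ∈ Rᶜ, p i) * ∏ i ∈ Rᶜ, p i := by
  classical
  have hp0 : ∀ i, 0 < p i := fun i => by have := hp i; omega
  set M := ∏ i ∈ Tᶜ, p i with hM
  have hM0 : 0 < M := Finset.prod_pos fun i _ => hp0 i
  obtain ⟨k, hk, hmax⟩ := Finset.exists_max_image T p (Finset.card_pos.1 (by omega))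
  have hcard : (T.erase k).card = r + 1 := by rw [Finset.card_erase_of_mem hk, hT]; rfl
  obtain ⟨j, hj, hmax'⟩ := Finset.exists_max_image (T.erase k) p (Finset.card_pos.1 (by omega))
  have hcard' : ((T.erase k).erase j).card = r := by rw [Finset.card_erase_of_mem hj, hcard]; rfl
  have hprod : ∏ i ∈ ((T.erase k).erase j)ᶜ, p i = p j * (p k * M) := by
    rw [prod_compl_erase hj, prod_compl_erase hk]
  have h1 := h.isMaximalPair.prod_le hp0 hcard'
  have h2 := card_hammingBall_one_le_mul_sum T x₀ hp0
  rw [← hM] at h2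
  have h3 : ∑ i ∈ T, (p i - 1) ≤ (p k - 1) + (r + 1) * (p j - 1) := by
    rw [← Finset.add_sum_erase _ _ hk, ← hcard, ← smul_eq_mul]
    exact Nat.add_le_add_left
      (Finset.sum_le_card_nsmul _ _ _ fun i hi => Nat.sub_le_sub_right (hmax' i hi) 1) _
  have h4 : p j * (p k * M) ≤ M * (1 + ∑ i ∈ T, (p i - 1)) := by
    rw [hprod, hA, hB] at h1
    exact (Nat.mul_self_le_mul_self_iff.1 h1).trans h2
  have h5 : p j * p k ≤ 1 + ((p k - 1) + (r + 1) * (p j - 1)) := by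
    refine le_of_mul_le_mul_left (a := M) ?_ hM0
    calc M * (p j * p k) = p j * (p k * M) := by ring
      _ ≤ _ := h4
      _ ≤ _ := Nat.mul_le_mul_left _ (by omega)
  have hpk : p k = r + 1 := by
    refine le_antisymm ?_ (hp k)
    by_contra! hlt
    obtain ⟨u, hu⟩ : ∃ u, p j = u + 1 := ⟨p j - 1, by have := hp0 j; omega⟩
    obtain ⟨q, hq⟩ : ∃ q, p k = q + 1 := ⟨p k - 1, by have := hp0 k; omega⟩
    have h6 := hp j
    rw [hu] at h5 h6
    rw [hq] at h5 hlt
    simp only [Nat.add_sub_cancel] at h5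
    have hu0 : 0 < u := by omega
    nlinarith
  have hpT : ∀ i ∈ T, p i = r + 1 := fun i hi => le_antisymm (hpk ▸ hmax i hi) (hp i)
  refine ⟨hpT, _, hcard', ?_⟩
  have h6 : (hammingBall x₀ T 1).card ≤ p j * (p k * M) := by
    refine h2.trans (le_of_eq ?_)
    rw [Finset.sum_congr rfl fun i hi => show p i - 1 = r by rw [hpT i hi]; rfl,
      Finset.sum_const, hT, hpT j (Finset.mem_of_mem_erase hj), hpk, smul_eq_mul]
    ring
  rw [hprod]
  exact Nat.mul_le_mul (hA ▸ h6) (hB ▸ h6)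

end Concentrated

/-! ### Classification of maximal pairs and passage to arbitrary pairs -/

/-- Maximal pairs when all coordinates have size at least `r + 1 ≥ 5`. -/
theorem IsMaximalPair.eq_fixing_or_ball {r : ℕ} {A B : Finset (Vec p)}
    (h : IsMaximalPair r A B) (hr : 4 ≤ r) (hrn : r ≤ n) (hp : ∀ i, r + 1 ≤ p i) :
    (A = B ∧ ((∃ T : Finset (Fin n), T.card = r ∧ IsFixing T A) ∨
      ∃ T : Finset (Fin n), T.card = r + 2 ∧ (∀ i ∈ T, p i = r + 1) ∧
        ∃ x₀ : Vec p, A = hammingBall x₀ T 1)) ∧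
    ∃ R : Finset (Fin n), R.card = r ∧
      A.card * B.card ≤ (∏ i ∈ Rᶜ, p i) * ∏ i ∈ Rᶜ, p i := by
  obtain ⟨T, x₀, hc⟩ := h.exists_concentrated (fun i => by have := hp i; omega) hrn
  have hp2 : ∀ i, 2 ≤ p i := fun i => by have := hp i; omega
  have hT := hc.card_le (by omega) hp2 fun i _ =>
    mul_log_lt_of_add_one_le (by exact_mod_cast hr) (by exact_mod_cast hp i)
  obtain ⟨a, b, hab, hA, hB⟩ := hc.exists_eq_hammingBall (by omega) hp2
    (fun i _ => by have := hp i; omega) hT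
  have ha := hc.radius_le_one hr hp hT hA
  have hb := hc.symm.radius_le_one hr hp hT hB
  obtain rfl | rfl : a = 0 ∨ a = 1 := by omega
  · obtain rfl | rfl : b = 0 ∨ b = 1 := by omega
    · refine ⟨⟨hA.trans hB.symm, Or.inl ⟨T, by omega, x₀, hA⟩⟩, T, by omega, ?_⟩
      rw [hA, hB, card_hammingBall_zero]
    · exact (hc.not_radius_zero_one (by omega) hp (by omega) hA hB).elim
  · obtain rfl | rfl : b = 0 ∨ b = 1 := by omega
    · exact (hc.symm.not_radius_zero_one (by omega) hp (by omega) hB hA).elim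
    · obtain ⟨h1, h2⟩ := hc.eq_of_radius_one_one (by omega) hp (by omega) hA hB
      exact ⟨⟨hA.trans hB.symm, Or.inr ⟨T, by omega, h1, x₀, hA⟩⟩, h2⟩

/-- Maximal pairs when all coordinates have size at least `r + 2`. -/
theorem IsMaximalPair.eq_fixing {r : ℕ} {A B : Finset (Vec p)}
    (h : IsMaximalPair r A B) (hr : 1 ≤ r) (hrn : r ≤ n) (hp : ∀ i, r + 2 ≤ p i) :
    (A = B ∧ ∃ T : Finset (Fin n), T.card = r ∧ IsFixing T A) ∧
    ∃ R : Finset (Fin n), R.card = r ∧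
      A.card * B.card ≤ (∏ i ∈ Rᶜ, p i) * ∏ i ∈ Rᶜ, p i := by
  obtain ⟨T, x₀, hc⟩ := h.exists_concentrated (fun i => by have := hp i; omega) hrn
  have hp2 : ∀ i, 2 ≤ p i := fun i => by have := hp i; omega
  have hT := hc.card_eq_of_le hr hp
  obtain ⟨hA, hB⟩ := hc.eq_hammingBall (a := 0) (b := 0) (by omega)
    (hc.symm.subset_hammingBall hp2 (by omega) fun i _ => by have := hp i; omega)
    (hc.subset_hammingBall hp2 (by omega) fun i _ => by have := hp i; omega)
  refine ⟨⟨hA.trans hB.symm, T, hT, x₀, hA⟩, T, hT, ?_⟩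
  rw [hA, hB, card_hammingBall_zero]

/-- Transfer from maximal pairs to arbitrary cross-intersecting pairs. -/
lemma CrossIntersecting.le_and_of_eq {r : ℕ} {A B : Finset (Vec p)}
    (h : CrossIntersecting r A B) (hmono : Monotone p)
    {P : Finset (Vec p) → Finset (Vec p) → Prop}
    (hP : ∀ A B : Finset (Vec p), IsMaximalPair r A B → P A B ∧
      ∃ R : Finset (Fin n), R.card = r ∧
        A.card * B.card ≤ (∏ i ∈ Rᶜ, p i) * ∏ i ∈ Rᶜ, p i) :
    A.card * B.card ≤ (∏ i ∈ Finset.univ.filter (fun i : Fin n => r ≤ i.val), p i ^ 2) ∧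
      (A.card * B.card = (∏ i ∈ Finset.univ.filter (fun i : Fin n => r ≤ i.val), p i ^ 2) →
        P A B) := by
  have hle : ∀ A' B' : Finset (Vec p), CrossIntersecting r A' B' → A'.card * B'.card ≤
      ∏ i ∈ Finset.univ.filter (fun i : Fin n => r ≤ i.val), p i ^ 2 := by
    intro A' B' h'
    obtain ⟨A₁, B₁, hmax⟩ := exists_isMaximalPair p r
    obtain ⟨-, R, hR, hRle⟩ := hP A₁ B₁ hmax
    have h1 := prod_compl_le_prod_filter hmono hR
    rw [Finset.prod_pow, sq]
    exact (hmax.2 A' B' h').trans (hRle.trans (Nat.mul_le_mul h1 h1))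
  -- A pair attaining the universal bound is itself maximal.
  exact ⟨hle A B h, fun heq => (hP A B ⟨h, fun A' B' h' => heq ▸ hle A' B' h'⟩).1⟩

end CrossInt

theorem theorem7 :
    -- the case `p₁ > r + 1`
    (∀ (n r : ℕ) (hr : 1 ≤ r) (hrn : r ≤ n) (p : Fin n → ℕ),
      CrossInt.IsSizeVector p → Monotone p →
      ∀ A B : Finset (CrossInt.Vec p), CrossInt.CrossIntersecting r A B →
      p ⟨0, hr.trans hrn⟩ > r + 1 →
        A.card * B.card ≤ (∏ i ∈ Finset.univ.filter (fun i : Fin n => r ≤ i.val), p i ^ 2) ∧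
        (A.card * B.card = (∏ i ∈ Finset.univ.filter (fun i : Fin n => r ≤ i.val), p i ^ 2) →
          A = B ∧ ∃ T : Finset (Fin n), T.card = r ∧ CrossInt.IsFixing T A)) ∧
    -- the case `p₁ = r + 1 > 4`
    (∀ (n r : ℕ) (hr : 1 ≤ r) (hrn : r ≤ n) (p : Fin n → ℕ),
      CrossInt.IsSizeVector p → Monotone p →
      ∀ A B : Finset (CrossInt.Vec p), CrossInt.CrossIntersecting r A B →
      p ⟨0, hr.trans hrn⟩ = r + 1 → r + 1 > 4 →
        A.card * B.card ≤ (∏ i ∈ Finset.univ.filter (fun i : Fin n => r ≤ i.val), p i ^ 2) ∧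
        (A.card * B.card = (∏ i ∈ Finset.univ.filter (fun i : Fin n => r ≤ i.val), p i ^ 2) →
          A = B ∧
          ((∃ T : Finset (Fin n), T.card = r ∧ CrossInt.IsFixing T A) ∨
            ∃ T : Finset (Fin n), T.card = r + 2 ∧ (∀ i ∈ T, p i = r + 1) ∧
              ∃ x₀ : CrossInt.Vec p, A = CrossInt.hammingBall x₀ T 1))) ∧
    -- the case `p₁ ≥ t(r)`, where `t(r) = r / 2 + o(r)`
    (∃ t : ℕ → ℝ,
      (fun r : ℕ => t r - (r : ℝ) / 2) =o[atTop] (fun r : ℕ => (r : ℝ)) ∧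
      ∀ (n r : ℕ) (hr : 1 ≤ r) (hrn : r ≤ n) (p : Fin n → ℕ),
        CrossInt.IsSizeVector p → Monotone p →
        ∀ A B : Finset (CrossInt.Vec p), CrossInt.IsMaximalPair r A B →
        (p ⟨0, hr.trans hrn⟩ : ℝ) ≥ t r →
          ∃ T : Finset (Fin n), T.card ≤ r + 3 ∧
            CrossInt.IsBallIn T A ∧ CrossInt.IsBallIn T B) := by
  have hle : ∀ {n r : ℕ} (hr : 1 ≤ r) (hrn : r ≤ n) {p : Fin n → ℕ}, Monotone p →
      ∀ i, p ⟨0, hr.trans hrn⟩ ≤ p i :=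
    fun hr hrn p hmono i => hmono (Fin.le_def.2 (Nat.zero_le _))
  refine ⟨?_, ?_, fun r => (r : ℝ) / 2 + 5 + r / Real.log (r + 3),
    CrossInt.isLittleO_threshold, ?_⟩
  · intro n r hr hrn p _ hmono A B hAB hp0
    exact hAB.le_and_of_eq hmono fun A' B' hmax =>
      hmax.eq_fixing hr hrn fun i => hp0.trans_le (hle hr hrn hmono i)
  · intro n r hr hrn p _ hmono A B hAB hp0 hr4
    exact hAB.le_and_of_eq hmono fun A' B' hmax =>
      hmax.eq_fixing_or_ball (by omega) hrn fun i => hp0 ▸ hle hr hrn hmono i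
  · intro n r hr hrn p hp hmono A B hmax ht
    have hr' : (1 : ℝ) ≤ r := by exact_mod_cast hr
    have ht' : ∀ i, (r : ℝ) / 2 + 5 + r / Real.log (r + 3) ≤ p i := fun i =>
      ht.le.trans (by exact_mod_cast hle hr hrn hmono i)
    have hp5 : ∀ i, 5 ≤ p i := by
      intro i
      have h1 : 0 < Real.log ((r : ℝ) + 3) := Real.log_pos (by linarith)
      have h2 : 0 < (r : ℝ) / Real.log (r + 3) := by positivity
      have h3 : (5 : ℝ) ≤ p i := by linarith [ht' i]
      exact_mod_cast h3
    obtain ⟨T, x₀, hc⟩ := hmax.exists_concentrated (fun i => by have := hp5 i; omega) hrn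
    have hT := hc.card_le hr hp fun i _ => CrossInt.mul_log_lt_of_threshold_le hr' (ht' i)
    obtain ⟨a, b, hab, hA, hB⟩ := hc.exists_eq_hammingBall hr hp (fun i _ => hp5 i) hT
    exact ⟨T, hT, ⟨x₀, a, by omega, hA⟩, ⟨x₀, b, by omega, hB⟩⟩
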